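/- Let $G_n=\sum_{m=0}^{n}\left(\prod_{j=1}^{m}\frac{2j-1}{2j}\right)^2$, $n=0,1,2,\dots$, be the Landau constants, let $\gamma$ be Euler's constant, and put $N=n+1$. Assume that $\alpha_1,\alpha_2,\dots$ are the (real) coefficients in the asymptotic expansion $$\pi G_n\sim \ln(16N)+\gamma+\sum_{k=1}^{\infty}\frac{\alpha_k}{N^k},\qquad n\to\infty,$$ that is, for every $l\ge 0$, $\pi G_n-\ln(16N)-\gamma-\sum_{k=1}^{l}\alpha_k N^{-k}=o(N^{-l})$ as $n\to\infty$. Then, as $k\to\infty$, $$\alpha_{2k}=(-1)^{k+1}\,\frac{2\,(2k-2)!}{(2\pi)^{2k}}\left(1+O\!\left(\frac1k\right)\right)$$ and $$\alpha_{2k+1}=(-1)^{k+1}\,\frac{8\,(2k)!\,\ln(2k+1)}{(2\pi)^{2k+2}}\left(1+O\!\left(\frac1{\ln k}\right)\right).$$ -/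

import Mathlib

open Filter Asymptotics
open scoped Nat Topology

noncomputable section

/-- The Landau constants
`G_n = 1 + (1/2)^2 + ((1*3)/(2*4))^2 + ... + ((1*3*...*(2n-1))/(2*4*...*(2n)))^2`. -/
def landauG (n : ℕ) : ℝ :=
  ∑ m ∈ Finset.range (n + 1), (∏ j ∈ Finset.Icc 1 m, (2 * (j : ℝ) - 1) / (2 * (j : ℝ))) ^ 2

/-- The truncation `A_l(N) = ln (16 N) + γ + ∑_{k=1}^l α_k / N^k`. -/
def truncation (α : ℕ → ℝ) (l : ℕ) (N : ℝ) : ℝ :=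
  Real.log (16 * N) + Real.eulerMascheroniConstant + ∑ k ∈ Finset.Icc 1 l, α k / N ^ k

/-- `α_1, α_2, ...` are the coefficients in the (Poincaré) asymptotic expansion
`π G_n ~ ln (16 N) + γ + ∑_{k ≥ 1} α_k / N^k` as `n → ∞`, where `N = n + 1`: for every `l ≥ 0`,
the error made by truncating after the `l`-th term is `o(N^{-l})`. The value `α 0` plays no role. -/
def IsLandauExpansion (α : ℕ → ℝ) : Prop :=
  ∀ l : ℕ, (fun n : ℕ => Real.pi * landauG n - truncation α l ((n : ℝ) + 1))
    =o[atTop] (fun n : ℕ => 1 / ((n : ℝ) + 1) ^ l)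

end

/-!
The summands `a_N` of `G_n` satisfy a two-term recurrence with quadratic coefficients, so the Borel
transform `φ` of the expansion of `π a_N` in powers of `1 / N` satisfies a linear differential
equation of order two. The function `e ^ (t / 4) φ t` is even, and with `t = 2 π i √v` it becomes
the solution `W` of the Legendre equation with `W(0) = 1`, that is `P_{-1/2} (cos (π √v))`. Since
`π (G_{n+1} - G_n) = π a_{n+1}`, the Borel transform of `∑ α_k N ^ (-k)` is, up to elementary
factors, `W` times a cosecant: the even `α_k` are the coefficients of
`(π √v / 2) W / sin (π √v / 2)` and the odd ones those of `2 sin (π √v / 2) W / sin (π √v)`.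

The singularity of `W` nearest to the origin is the logarithmic one at `v = 1`. Its strength is the
limit at `v = 1` of the flux `sin (π √v) / (π √v) · v W'(v)`. Comparison with the hypergeometric
series `F = ∑ a_m z ^ m` at `z = sin² (π √v / 2)` identifies that limit with the limit at `z = 1` of
`z (1 - z) F'(z)`, which by Abel's theorem is `lim n a_n = 1 / π`, that is Wallis' product. Hence
`W ≈ -(2 / π) log (1 - v)`, and the coefficients of the two products follow: like `1 / k` in the
even case, and like the harmonic numbers, because of the additional pole of `1 / sin (π √v)` at
`v = 1`, in the odd case.
-/

open PowerSeries (C X coeff constantCoeff trunc exp rescale)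
open scoped PowerSeries

noncomputable section

/-! ### Asymptotic expansions -/

/-- The asymptotic expansion `u ~ ∑ p_k x ^ k` along the filter `l`, in powers of the scale `x`. -/
def HasExpansion {ι : Type*} (l : Filter ι) (x u : ι → ℝ) (p : ℝ⟦X⟧) : Prop :=
  ∀ m : ℕ, (fun i => u i - (trunc m p).eval (x i)) =O[l] fun i => x i ^ m

lemma X_pow_dvd_sub_trunc {R : Type*} [CommRing R] (p : R⟦X⟧) (m : ℕ) :
    X ^ m ∣ p - (trunc m p : R⟦X⟧) := by
  refine PowerSeries.X_pow_dvd_iff.2 fun k hk => ?_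
  rw [map_sub, Polynomial.coeff_coe, PowerSeries.coeff_trunc, if_pos hk, sub_self]

lemma isBigO_eval_of_isBigO_one {ι : Type*} {l : Filter ι} {x : ι → ℝ}
    (hx : x =O[l] fun _ => (1 : ℝ)) (P : Polynomial ℝ) :
    (fun i => P.eval (x i)) =O[l] fun _ => (1 : ℝ) := by
  simp only [Polynomial.eval_eq_sum_range]
  refine IsBigO.fun_sum fun k _ => ?_
  simpa using (hx.pow k).const_mul_left (P.coeff k)

namespace HasExpansion

variable {ι : Type*} {l : Filter ι} {x y u v : ι → ℝ} {p q : ℝ⟦X⟧}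

lemma of_dvd (hx : x =O[l] fun _ => (1 : ℝ))
    (h : ∀ m, ∃ P : Polynomial ℝ, X ^ m ∣ p - (P : ℝ⟦X⟧) ∧
      (fun i => u i - P.eval (x i)) =O[l] fun i => x i ^ m) :
    HasExpansion l x u p := by
  intro m
  obtain ⟨P, hP, hu⟩ := h m
  obtain ⟨Q, hQ⟩ : Polynomial.X ^ m ∣ P - trunc m p := by
    refine Polynomial.X_pow_dvd_iff.2 fun k hk => ?_
    have h0 := PowerSeries.X_pow_dvd_iff.1 hP k hk
    rw [map_sub, Polynomial.coeff_coe] at h0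
    rw [Polynomial.coeff_sub, PowerSeries.coeff_trunc, if_pos hk]
    linarith
  have hQx : (fun i => x i ^ m * Q.eval (x i)) =O[l] fun i => x i ^ m := by
    simpa using (isBigO_refl (fun i => x i ^ m) l).mul (isBigO_eval_of_isBigO_one hx Q)
  refine (hu.add hQx).congr_left fun i => ?_
  have hi := congrArg (Polynomial.eval (x i)) hQ
  simp only [Polynomial.eval_sub, Polynomial.eval_mul, Polynomial.eval_pow,
    Polynomial.eval_X] at hi
  linarith

lemma polynomial (hx : x =O[l] fun _ => (1 : ℝ)) (P : Polynomial ℝ) :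
    HasExpansion l x (fun i => P.eval (x i)) P :=
  of_dvd hx fun m => ⟨P, by simp, by simpa using isBigO_zero _ _⟩

lemma isBigO_one (h : HasExpansion l x u p) : u =O[l] fun _ => (1 : ℝ) := by
  simpa [PowerSeries.trunc_zero'] using h 0

lemma isBigO (h : HasExpansion l x u p) (hp : constantCoeff p = 0) : u =O[l] x := by
  simpa [PowerSeries.trunc_one_left, hp] using h 1

lemma add (hu : HasExpansion l x u p) (hv : HasExpansion l x v q) :
    HasExpansion l x (fun i => u i + v i) (p + q) := fun m =>
  ((hu m).add (hv m)).congr_left fun i => by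
    rw [map_add, Polynomial.eval_add]
    ring

lemma neg (hu : HasExpansion l x u p) : HasExpansion l x (fun i => -u i) (-p) := fun m =>
  (hu m).neg_left.congr_left fun i => by
    rw [map_neg, Polynomial.eval_neg]
    ring

lemma sub (hu : HasExpansion l x u p) (hv : HasExpansion l x v q) :
    HasExpansion l x (fun i => u i - v i) (p - q) := by
  simpa only [sub_eq_add_neg] using hu.add hv.neg

lemma mul (hx : x =O[l] fun _ => (1 : ℝ)) (hu : HasExpansion l x u p)
    (hv : HasExpansion l x v q) : HasExpansion l x (fun i => u i * v i) (p * q) := by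
  refine of_dvd hx fun m => ⟨trunc m p * trunc m q, ?_, ?_⟩
  · have hdvd := ((X_pow_dvd_sub_trunc q m).mul_left p).add
      ((X_pow_dvd_sub_trunc p m).mul_right (trunc m q : ℝ⟦X⟧))
    convert hdvd using 1
    push_cast
    ring
  · have h1 := hu.isBigO_one.mul (hv m)
    have h2 := (hu m).mul (isBigO_eval_of_isBigO_one hx (trunc m q))
    simp only [one_mul, mul_one] at h1 h2
    refine (h1.add h2).congr_left fun i => ?_
    rw [Polynomial.eval_mul]
    ring

lemma isBigO_of_dvd (h : HasExpansion l x u p) {m : ℕ}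
    (hp : X ^ m ∣ p) : u =O[l] fun i => x i ^ m := by
  have htrunc : trunc m p = 0 := by
    ext k
    rw [PowerSeries.coeff_trunc, Polynomial.coeff_zero, ite_eq_right_iff]
    exact PowerSeries.X_pow_dvd_iff.1 hp k
  simpa [htrunc] using h m

lemma tendsto (hx : Tendsto x l (𝓝 0)) (h : HasExpansion l x u p) :
    Tendsto u l (𝓝 (constantCoeff p)) := by
  have h1 := ((h 1).congr_right fun i => pow_one (x i)).trans_tendsto hx
  simpa [PowerSeries.trunc_one_left] using h1.add_const (constantCoeff p)

lemma inv (hx : Tendsto x l (𝓝 0)) (h : HasExpansion l x u p) (hp : constantCoeff p ≠ 0) :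
    HasExpansion l x (fun i => (u i)⁻¹) p⁻¹ := by
  have hx1 := hx.isBigO_one ℝ
  intro m
  have hdvd : X ^ m ∣ 1 - p * (trunc m p⁻¹ : ℝ⟦X⟧) := by
    rw [← PowerSeries.mul_inv_cancel p hp, ← mul_sub]
    exact (X_pow_dvd_sub_trunc p⁻¹ m).mul_left p
  have hone : HasExpansion l x (fun _ => 1) 1 := by simpa using polynomial hx1 1
  have h1 := (hone.sub (h.mul hx1 (polynomial hx1 (trunc m p⁻¹)))).isBigO_of_dvd hdvd
  have h2 := (((h.tendsto hx).inv₀ hp).isBigO_one ℝ).mul h1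
  refine h2.congr' ?_ (Eventually.of_forall fun i => one_mul _)
  filter_upwards [(h.tendsto hx).eventually_ne hp] with i hi
  field_simp

lemma aeval (hx : x =O[l] fun _ => (1 : ℝ)) (hy : HasExpansion l x y q) (P : Polynomial ℝ) :
    HasExpansion l x (fun i => P.eval (y i)) (P.aeval q) := by
  induction P using Polynomial.induction_on' with
  | add P Q hP hQ => simpa using hP.add hQ
  | monomial n a =>
    induction n with
    | zero => simpa using polynomial hx (Polynomial.C a)
    | succ n ih =>
      simpa [Polynomial.aeval_monomial, pow_succ, mul_assoc] using ih.mul hx hy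

lemma subst (hx : x =O[l] fun _ => (1 : ℝ)) (hu : HasExpansion l y u p)
    (hy : HasExpansion l x y q) (hq : constantCoeff q = 0) :
    HasExpansion l x u (p.subst q) := by
  have hs : PowerSeries.HasSubst q := .of_constantCoeff_zero' hq
  refine of_dvd hx fun m => ⟨trunc m ((trunc m p).aeval q), ?_, ?_⟩
  · have hdvd : X ^ m ∣ p.subst q - (trunc m p).aeval q := by
      obtain ⟨r, hr⟩ := X_pow_dvd_sub_trunc p m
      rw [← PowerSeries.subst_coe hs, ← PowerSeries.subst_sub hs, hr, PowerSeries.subst_mul hs,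
        PowerSeries.subst_pow hs, PowerSeries.subst_X hs]
      exact (pow_dvd_pow_of_dvd (PowerSeries.X_dvd_iff.2 hq) m).mul_right _
    simpa using dvd_add hdvd (X_pow_dvd_sub_trunc ((trunc m p).aeval q) m)
  · have h1 := (hu m).trans ((hy.isBigO hq).pow m)
    exact (h1.add (hy.aeval hx (trunc m p) m)).congr_left fun i => by ring

lemma eq_zero (hx : Tendsto x l (𝓝 0)) (hx0 : ∃ᶠ i in l, x i ≠ 0)
    (h : HasExpansion l x (fun _ => 0) p) : p = 0 := by
  by_contra hp
  set m := p.order.toNat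
  have hpm : coeff m p ≠ 0 := PowerSeries.coeff_order hp
  have htrunc : trunc (m + 1) p = Polynomial.monomial m (coeff m p) := by
    ext k
    rw [PowerSeries.coeff_trunc, Polynomial.coeff_monomial]
    split_ifs with h1 h2 h2
    · rw [h2]
    · exact PowerSeries.coeff_of_lt_order_toNat k (by omega)
    · omega
    · rfl
  have h1 : (fun i => x i ^ m) =O[l] fun i => x i ^ (m + 1) := by
    have h2 := (h (m + 1)).neg_left
    simp only [htrunc, Polynomial.eval_monomial, zero_sub, neg_neg] at h2
    exact (isBigO_const_mul_left_iff hpm).1 h2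
  have h2 : (fun i => x i ^ (m + 1)) =o[l] fun i => x i ^ m := by
    simpa [pow_succ] using
      (isBigO_refl (fun i => x i ^ m) l).mul_isLittleO ((isLittleO_one_iff ℝ).2 hx)
  exact isLittleO_irrefl (hx0.mono fun i hi => pow_ne_zero m hi) (h1.trans_isLittleO h2)

lemma unique (hx : Tendsto x l (𝓝 0)) (hx0 : ∃ᶠ i in l, x i ≠ 0)
    (hp : HasExpansion l x u p) (hq : HasExpansion l x u q) : p = q :=
  sub_eq_zero.1 <| eq_zero hx hx0 <| by simpa using hp.sub hq

lemma of_hasFPowerSeriesAt {f : ℝ → ℝ} (hx : Tendsto x l (𝓝 0))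
    (hf : HasFPowerSeriesAt f (.ofScalars ℝ fun n => coeff n p) 0) :
    HasExpansion l x (fun i => f (x i)) p := fun m =>
  ((((hf.isBigO_sub_partialSum_pow m).comp_tendsto hx).congr_right
    fun i => (norm_pow (x i) m).symm).of_norm_right).congr_left fun i => by
      simp [FormalMultilinearSeries.partialSum, FormalMultilinearSeries.ofScalars,
        Polynomial.eval, PowerSeries.eval₂_trunc_eq_sum_range]

end HasExpansion

/-! ### The Borel transform -/

/-- The Borel transform `∑ p_k X ^ k ↦ ∑ p_{k+1} X ^ k / k!`. -/
def borelTransform : ℝ⟦X⟧ →ₗ[ℝ] ℝ⟦X⟧ where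
  toFun p := PowerSeries.mk fun n => coeff (n + 1) p / (n ! : ℝ)
  map_add' p q := by ext n; simp [add_div]
  map_smul' c p := by ext n; simp [mul_div_assoc]

lemma coeff_borelTransform (p : ℝ⟦X⟧) (n : ℕ) :
    coeff n (borelTransform p) = coeff (n + 1) p / (n ! : ℝ) := by
  simp [borelTransform]

lemma derivative_borelTransform_X_mul (p : ℝ⟦X⟧) :
    d⁄dX ℝ (borelTransform (X * p)) = borelTransform p := by
  ext n
  rw [PowerSeries.coeff_derivative, coeff_borelTransform, coeff_borelTransform,
    PowerSeries.coeff_succ_X_mul, Nat.factorial_succ]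
  push_cast
  field_simp

/-- The power series of `exp (c t)`. -/
def expSeries (c : ℝ) : ℝ⟦X⟧ := rescale c (exp ℝ)

lemma coeff_expSeries (c : ℝ) (n : ℕ) : coeff n (expSeries c) = c ^ n / (n ! : ℝ) := by
  simp [expSeries, PowerSeries.coeff_exp, div_eq_mul_inv]

lemma constantCoeff_expSeries (c : ℝ) : constantCoeff (expSeries c) = 1 := by
  rw [← PowerSeries.coeff_zero_eq_constantCoeff_apply, coeff_expSeries]
  simp

lemma expSeries_zero : expSeries 0 = 1 := by
  simp [expSeries]

lemma expSeries_add (a b : ℝ) : expSeries (a + b) = expSeries a * expSeries b :=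
  (PowerSeries.exp_mul_exp_eq_exp_add a b).symm

lemma rescale_expSeries (a c : ℝ) : rescale a (expSeries c) = expSeries (c * a) := by
  rw [expSeries, PowerSeries.rescale_rescale, expSeries]

lemma derivative_rescale (c : ℝ) (p : ℝ⟦X⟧) :
    d⁄dX ℝ (rescale c p) = C c * rescale c (d⁄dX ℝ p) := by
  ext n
  simp only [PowerSeries.coeff_derivative, PowerSeries.coeff_rescale, PowerSeries.coeff_C_mul]
  ring

lemma derivative_expSeries (c : ℝ) :
    d⁄dX ℝ (expSeries c) = C c * expSeries c := by
  rw [expSeries, derivative_rescale, PowerSeries.derivative_exp]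

/-- The effect of `N ↦ N + 1` on power series in `1 / N`. -/
def shiftSeries (p : ℝ⟦X⟧) : ℝ⟦X⟧ := p.subst (X * (1 + X)⁻¹ : ℝ⟦X⟧)

lemma hasSubst_X_mul_inv_one_add_X : PowerSeries.HasSubst (X * (1 + X)⁻¹ : ℝ⟦X⟧) :=
  .of_constantCoeff_zero' (by simp)

lemma inv_one_add_X_pow_succ (k : ℕ) :
    ((1 + X)⁻¹ ^ (k + 1) : ℝ⟦X⟧) =
      rescale (-1) (PowerSeries.mk fun n => ((k + n).choose k : ℝ)) := by
  have h : (1 + X : ℝ⟦X⟧)⁻¹ = rescale (-1) (PowerSeries.mk 1) := by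
    rw [PowerSeries.inv_eq_iff_mul_eq_one (by simp)]
    simpa [PowerSeries.rescale_X] using
      congrArg (rescale (-1 : ℝ)) (PowerSeries.mk_one_mul_one_sub_eq_one ℝ)
  rw [h, ← map_pow, PowerSeries.mk_one_pow_eq_mk_choose_add]

lemma coeff_X_mul_inv_one_add_X_pow {k n : ℕ} (h : k ≤ n) :
    coeff (n + 1) ((X * (1 + X)⁻¹ : ℝ⟦X⟧) ^ (k + 1)) = (-1) ^ (n - k) * (n.choose k : ℝ) := by
  obtain ⟨j, rfl⟩ := Nat.exists_eq_add_of_le' h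
  rw [mul_pow, show j + k + 1 = j + (k + 1) by ring, PowerSeries.coeff_X_pow_mul,
    inv_one_add_X_pow_succ]
  simp [add_comm k]

lemma coeff_succ_shiftSeries (p : ℝ⟦X⟧) (n : ℕ) :
    coeff (n + 1) (shiftSeries p) =
      ∑ k ∈ Finset.range (n + 1), coeff (k + 1) p * ((-1) ^ (n - k) * (n.choose k : ℝ)) := by
  rw [shiftSeries, PowerSeries.coeff_subst' hasSubst_X_mul_inv_one_add_X,
    finsum_eq_sum_of_support_subset (s := Finset.range (n + 2)), Finset.sum_range_succ']
  · simp only [smul_eq_mul, pow_zero, PowerSeries.coeff_one, Nat.succ_ne_zero, if_false, mul_zero,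
      add_zero]
    refine Finset.sum_congr rfl fun k hk => ?_
    rw [coeff_X_mul_inv_one_add_X_pow (Finset.mem_range_succ_iff.1 hk)]
  · intro k hk
    by_contra hkn
    refine hk ?_
    simp only [Finset.coe_range, Set.mem_Iio, not_lt] at hkn
    simp only [mul_pow, PowerSeries.coeff_X_pow_mul', if_neg (Nat.not_le.2 hkn), smul_zero]

lemma borelTransform_shiftSeries (p : ℝ⟦X⟧) :
    borelTransform (shiftSeries p) = expSeries (-1) * borelTransform p := by
  ext n
  rw [coeff_borelTransform, coeff_succ_shiftSeries, mul_comm, PowerSeries.coeff_mul,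
    Finset.Nat.sum_antidiagonal_eq_sum_range_succ_mk, Finset.sum_div]
  refine Finset.sum_congr rfl fun k hk => ?_
  have hkn := Finset.mem_range_succ_iff.1 hk
  rw [coeff_borelTransform, coeff_expSeries, Nat.cast_choose ℝ hkn]
  have : (n ! : ℝ) ≠ 0 := by positivity
  field_simp

/-! ### The expansion of the summands -/

/-- The `m`-th summand of the Landau constants. -/
def landauTerm (m : ℕ) : ℝ := (∏ j ∈ Finset.Icc 1 m, (2 * (j : ℝ) - 1) / (2 * (j : ℝ))) ^ 2

lemma landauTerm_zero : landauTerm 0 = 1 := by simp [landauTerm]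

lemma landauTerm_succ (m : ℕ) :
    landauTerm (m + 1) = landauTerm m * ((2 * (m : ℝ) + 1) / (2 * (m : ℝ) + 2)) ^ 2 := by
  rw [landauTerm, Finset.prod_Icc_succ_top (by omega), mul_pow, landauTerm]
  push_cast
  congr 3 <;> ring

lemma landauG_succ (n : ℕ) : landauG (n + 1) = landauG n + landauTerm (n + 1) :=
  Finset.sum_range_succ _ _

lemma tendsto_one_div_succ : Tendsto (fun n : ℕ => 1 / ((n : ℝ) + 1)) atTop (𝓝 0) :=
  tendsto_one_div_add_atTop_nhds_zero_nat

namespace HasExpansion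

lemma shift {u : ℕ → ℝ} {p : ℝ⟦X⟧}
    (h : HasExpansion atTop (fun n : ℕ => 1 / ((n : ℝ) + 1)) u p) :
    HasExpansion atTop (fun n : ℕ => 1 / ((n : ℝ) + 1)) (fun n => u (n + 1)) (shiftSeries p) := by
  have hx := tendsto_one_div_succ.isBigO_one ℝ
  have hX : HasExpansion atTop (fun n : ℕ => 1 / ((n : ℝ) + 1))
      (fun n => 1 / ((n : ℝ) + 1)) X := by
    simpa using polynomial hx Polynomial.X
  have hX1 : HasExpansion atTop (fun n : ℕ => 1 / ((n : ℝ) + 1))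
      (fun n => 1 + 1 / ((n : ℝ) + 1)) (1 + X) := by
    simpa using (polynomial hx 1).add hX
  have hsucc : HasExpansion atTop (fun n : ℕ => 1 / ((n : ℝ) + 1))
      (fun n => 1 / (((n + 1 : ℕ) : ℝ) + 1)) (X * (1 + X)⁻¹) := by
    convert hX.mul hx (hX1.inv tendsto_one_div_succ (by simp)) using 2 with n
    push_cast
    field_simp
  have hu : HasExpansion atTop (fun n : ℕ => 1 / (((n + 1 : ℕ) : ℝ) + 1)) (fun n => u (n + 1)) p :=
    fun m => (h m).comp_tendsto (tendsto_add_atTop_nat 1)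
  exact hu.subst hx hsucc (by simp)

end HasExpansion

/-- The power series with coefficients `α 1, α 2, …` and vanishing constant term. -/
def coeffSeries (α : ℕ → ℝ) : ℝ⟦X⟧ := PowerSeries.mk fun k => if k = 0 then 0 else α k

variable {α : ℕ → ℝ}

lemma eval_trunc_succ_coeffSeries (α : ℕ → ℝ) (m : ℕ) (x : ℝ) :
    (trunc (m + 1) (coeffSeries α)).eval (1 / x) = ∑ k ∈ Finset.Icc 1 m, α k / x ^ k := by
  rw [Polynomial.eval, PowerSeries.eval₂_trunc_eq_sum_range, Finset.range_eq_Ico,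
    Finset.sum_eq_sum_Ico_succ_bot (Nat.succ_pos m)]
  simp only [coeffSeries, PowerSeries.coeff_mk, if_true, map_zero, zero_mul, zero_add]
  refine Finset.sum_congr rfl fun k hk => ?_
  rw [if_neg (Nat.one_le_iff_ne_zero.1 (Finset.mem_Ico.1 hk).1), RingHom.id_apply, one_div,
    inv_pow, div_eq_mul_inv]

lemma IsLandauExpansion.hasExpansion (hα : IsLandauExpansion α) :
    HasExpansion atTop (fun n : ℕ => 1 / ((n : ℝ) + 1)) (fun n => Real.pi * landauG n -
      Real.log (16 * ((n : ℝ) + 1)) - Real.eulerMascheroniConstant) (coeffSeries α) := by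
  refine .of_dvd (tendsto_one_div_succ.isBigO_one ℝ) fun m =>
    ⟨trunc (m + 1) (coeffSeries α), (pow_dvd_pow X m.le_succ).trans (X_pow_dvd_sub_trunc _ _), ?_⟩
  refine ((hα m).isBigO.congr_left fun n => ?_).congr_right fun n => by rw [one_div_pow]
  rw [eval_trunc_succ_coeffSeries, truncation]
  ring

lemma hasExpansion_log_one_add {ι : Type*} {l : Filter ι} {x : ι → ℝ} (hx : Tendsto x l (𝓝 0)) :
    HasExpansion l x (fun i => Real.log (1 + x i)) (PowerSeries.log ℝ) := by
  refine .of_hasFPowerSeriesAt (f := fun y => Real.log (1 + y)) hx ?_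
  convert hasFPowerSeriesAt_log_one_add using 3 with n
  rcases eq_or_ne n 0 with rfl | hn <;> simp [PowerSeries.coeff_log, pow_succ, *]

/-- The expansion of `π a_N` in powers of `1 / N`, where `a_N` is the `N`-th summand. -/
def termSeries (α : ℕ → ℝ) : ℝ⟦X⟧ :=
  PowerSeries.log ℝ + shiftSeries (coeffSeries α) - coeffSeries α

lemma IsLandauExpansion.hasExpansion_landauTerm (hα : IsLandauExpansion α) :
    HasExpansion atTop (fun n : ℕ => 1 / ((n : ℝ) + 1)) (fun n => Real.pi * landauTerm (n + 1))
      (termSeries α) := by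
  rw [termSeries]
  convert ((hasExpansion_log_one_add tendsto_one_div_succ).add hα.hasExpansion.shift).sub
    hα.hasExpansion using 2 with n
  have hlog : Real.log (1 + 1 / ((n : ℝ) + 1)) = Real.log ((n : ℝ) + 2) - Real.log (n + 1) := by
    rw [← Real.log_div (by positivity) (by positivity)]
    congr 1
    field_simp
    ring
  rw [hlog, landauG_succ, Real.log_mul (by norm_num) (by positivity),
    Real.log_mul (by norm_num) (by positivity)]
  push_cast
  ring_nf

lemma IsLandauExpansion.one_add_X_sq_mul_shiftSeries_termSeries (hα : IsLandauExpansion α) :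
    (1 + X) ^ 2 * shiftSeries (termSeries α) = (1 + X + C (1 / 4) * X ^ 2) * termSeries α := by
  have hx := tendsto_one_div_succ.isBigO_one ℝ
  have h := hα.hasExpansion_landauTerm
  have hl := (HasExpansion.polynomial hx ((1 + Polynomial.X) ^ 2)).mul hx h.shift
  have hr := (HasExpansion.polynomial hx
    (1 + Polynomial.X + Polynomial.C (1 / 4) * Polynomial.X ^ 2)).mul hx h
  refine HasExpansion.unique
    (u := fun n : ℕ => (1 + 1 / ((n : ℝ) + 1)) ^ 2 * (Real.pi * landauTerm (n + 2)))
    tendsto_one_div_succ (Frequently.of_forall fun n => by positivity) ?_ ?_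
  · simpa using hl
  · convert hr using 2 with n
    · rw [landauTerm_succ (n + 1)]
      simp
      field_simp
      ring
    · simp

lemma IsLandauExpansion.borelTransform_termSeries_ode (hα : IsLandauExpansion α) :
    expSeries (-1) * d⁄dX ℝ (d⁄dX ℝ (borelTransform (termSeries α))) =
      d⁄dX ℝ (d⁄dX ℝ (borelTransform (termSeries α))) + d⁄dX ℝ (borelTransform (termSeries α)) +
        C (1 / 4) * borelTransform (termSeries α) := by
  have h := congrArg (fun p => d⁄dX ℝ (d⁄dX ℝ (borelTransform p)))
    hα.one_add_X_sq_mul_shiftSeries_termSeries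
  have hl (p : ℝ⟦X⟧) : (1 + X) ^ 2 * p = p + (2 : ℝ) • (X * p) + X * (X * p) := by
    rw [PowerSeries.smul_eq_C_mul, map_ofNat]
    ring
  have hr (p : ℝ⟦X⟧) : (1 + X + C (1 / 4) * X ^ 2) * p =
      p + X * p + (1 / 4 : ℝ) • (X * (X * p)) := by
    rw [PowerSeries.smul_eq_C_mul]
    ring
  simp only [hl, hr, map_add, map_smul, Derivation.map_smul, derivative_borelTransform_X_mul,
    borelTransform_shiftSeries, Derivation.leibniz, derivative_expSeries, smul_eq_mul] at h
  simp only [PowerSeries.smul_eq_C_mul, Derivation.map_one_eq_zero, map_neg, map_one,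
    map_ofNat] at h
  linear_combination h

lemma X_mul_borelTransform_log : X * borelTransform (PowerSeries.log ℝ) = 1 - expSeries (-1) := by
  ext n
  rcases n with _ | n
  · simp [constantCoeff_expSeries]
  · rw [PowerSeries.coeff_succ_X_mul, map_sub, coeff_expSeries, PowerSeries.coeff_one,
      if_neg n.succ_ne_zero, coeff_borelTransform, PowerSeries.coeff_log, Nat.factorial_succ]
    simp [pow_succ]
    field_simp

lemma X_mul_borelTransform_termSeries (α : ℕ → ℝ) :
    X * borelTransform (termSeries α) =
      (1 - expSeries (-1)) * (1 - X * borelTransform (coeffSeries α)) := by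
  rw [termSeries, map_sub, map_add, borelTransform_shiftSeries]
  linear_combination X_mul_borelTransform_log

/-! ### Even power series -/

/-- The Euler operator `X d/dX` on power series. -/
def euler : Derivation ℝ ℝ⟦X⟧ ℝ⟦X⟧ := (X : ℝ⟦X⟧) • d⁄dX ℝ

lemma euler_apply (p : ℝ⟦X⟧) : euler p = X * d⁄dX ℝ p := rfl

lemma coeff_euler (p : ℝ⟦X⟧) (n : ℕ) : coeff n (euler p) = n * coeff n p := by
  rcases n with _ | n
  · simp [euler_apply]
  · rw [euler_apply, PowerSeries.coeff_succ_X_mul, PowerSeries.coeff_derivative]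
    push_cast
    ring

lemma euler_C_mul (c : ℝ) (p : ℝ⟦X⟧) : euler (C c * p) = C c * euler p := by
  rw [← PowerSeries.smul_eq_C_mul, Derivation.map_smul, PowerSeries.smul_eq_C_mul]

lemma euler_rescale (c : ℝ) (p : ℝ⟦X⟧) : euler (rescale c p) = rescale c (euler p) := by
  ext n
  simp only [coeff_euler, PowerSeries.coeff_rescale]
  ring

lemma eq_zero_of_euler_ode {S r p : ℝ⟦X⟧} (hS : constantCoeff S ≠ 0) (hr : constantCoeff r = 0)
    (hp : constantCoeff p = 0) (h : euler (S * euler p) = r * p) : p = 0 := by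
  ext n
  induction n using Nat.strong_induction_on with
  | _ n ih =>
    rcases eq_or_ne n 0 with rfl | hn
    · simpa using hp
    have hlead : coeff n (S * euler p) = constantCoeff S * (n * coeff n p) := by
      obtain ⟨k, hk⟩ : X ^ n ∣ euler p := PowerSeries.X_pow_dvd_iff.2 fun j hj => by
        rw [coeff_euler, ih j hj, map_zero, mul_zero]
      rw [← coeff_euler, hk, mul_left_comm]
      simp [PowerSeries.coeff_X_pow_mul']
    have hrhs : coeff n (r * p) = 0 := by
      have hdvd : X ^ (1 + n) ∣ r * p := by
        rw [pow_add, pow_one]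
        exact mul_dvd_mul (PowerSeries.X_dvd_iff.2 hr) (PowerSeries.X_pow_dvd_iff.2 ih)
      exact PowerSeries.X_pow_dvd_iff.1 hdvd n (by omega)
    have hn' : (n : ℝ) ≠ 0 := Nat.cast_ne_zero.2 hn
    have h0 := congrArg (coeff n) h
    rw [coeff_euler, hlead, hrhs] at h0
    simpa [hn', hS] using h0

/-- The constant `κ` for which `v = κ t ^ 2` when `t = 2 π i √v`. -/
def evenScale : ℝ := -(1 / (4 * Real.pi ^ 2))

lemma neg_pi_sq_mul_evenScale : -Real.pi ^ 2 * evenScale = (1 / 2) ^ 2 := by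
  have := Real.pi_pos
  rw [evenScale]
  field_simp
  norm_num

lemma evenScale_ne_zero : evenScale ≠ 0 := by
  rintro h
  have := neg_pi_sq_mul_evenScale
  norm_num [h] at this

lemma evenScale_pow (k : ℕ) : evenScale ^ k = (-1) ^ k / (2 * Real.pi) ^ (2 * k) := by
  rw [pow_mul, ← div_pow]
  congr 1
  rw [evenScale]
  ring

/-- The substitution `v ↦ κ t ^ 2`, an embedding of power series as even power series. -/
def evenEmbedding : ℝ⟦X⟧ →+* ℝ⟦X⟧ :=
  (PowerSeries.expand 2 two_ne_zero : ℝ⟦X⟧ →ₐ[ℝ] ℝ⟦X⟧).toRingHom.comp (rescale evenScale)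

lemma coeff_evenEmbedding_even (p : ℝ⟦X⟧) (m : ℕ) :
    coeff (2 * m) (evenEmbedding p) = evenScale ^ m * coeff m p := by
  simp only [evenEmbedding, RingHom.comp_apply, AlgHom.toRingHom_eq_coe, RingHom.coe_coe]
  rw [PowerSeries.coeff_expand_mul, PowerSeries.coeff_rescale]

lemma coeff_evenEmbedding_odd (p : ℝ⟦X⟧) (m : ℕ) :
    coeff (2 * m + 1) (evenEmbedding p) = 0 := by
  simp only [evenEmbedding, RingHom.comp_apply, AlgHom.toRingHom_eq_coe, RingHom.coe_coe]
  exact PowerSeries.coeff_expand_of_not_dvd _ _ _ (by omega)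

lemma constantCoeff_evenEmbedding (p : ℝ⟦X⟧) :
    constantCoeff (evenEmbedding p) = constantCoeff p := by
  simpa using coeff_evenEmbedding_even p 0

lemma ext_even_odd {p q : ℝ⟦X⟧} (h0 : ∀ m, coeff (2 * m) p = coeff (2 * m) q)
    (h1 : ∀ m, coeff (2 * m + 1) p = coeff (2 * m + 1) q) : p = q := by
  ext n
  rcases Nat.even_or_odd' n with ⟨m, rfl | rfl⟩
  · exact h0 m
  · exact h1 m

lemma evenEmbedding_injective : Function.Injective evenEmbedding := by
  intro p q h
  ext m
  have hm := congrArg (coeff (2 * m)) h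
  rw [coeff_evenEmbedding_even, coeff_evenEmbedding_even] at hm
  exact mul_left_cancel₀ (pow_ne_zero m evenScale_ne_zero) hm

lemma exists_evenEmbedding_eq {p : ℝ⟦X⟧} (hp : rescale (-1) p = p) :
    ∃ q, evenEmbedding q = p := by
  refine ⟨PowerSeries.mk fun m => coeff (2 * m) p / evenScale ^ m,
    ext_even_odd (fun m => ?_) fun m => ?_⟩
  · have := evenScale_ne_zero
    rw [coeff_evenEmbedding_even, PowerSeries.coeff_mk]
    field_simp
  · have hm := congrArg (coeff (2 * m + 1)) hp
    rw [PowerSeries.coeff_rescale, (odd_two_mul_add_one m).neg_one_pow] at hm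
    rw [coeff_evenEmbedding_odd]
    linarith

lemma rescale_evenEmbedding (c : ℝ) (p : ℝ⟦X⟧) :
    rescale c (evenEmbedding p) = evenEmbedding (rescale (c ^ 2) p) := by
  refine ext_even_odd (fun m => ?_) fun m => ?_
  · simp only [PowerSeries.coeff_rescale, coeff_evenEmbedding_even, pow_mul]
    ring
  · simp only [PowerSeries.coeff_rescale, coeff_evenEmbedding_odd, mul_zero]

lemma euler_evenEmbedding (p : ℝ⟦X⟧) :
    euler (evenEmbedding p) = C 2 * evenEmbedding (euler p) := by
  refine ext_even_odd (fun m => ?_) fun m => ?_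
  · simp only [coeff_euler, PowerSeries.coeff_C_mul, coeff_evenEmbedding_even]
    push_cast
    ring
  · simp only [coeff_euler, PowerSeries.coeff_C_mul, coeff_evenEmbedding_odd, mul_zero]

lemma evenEmbedding_C (c : ℝ) : evenEmbedding (C c) = C c := by
  have h : rescale evenScale (C c) = C c := by
    ext n
    rcases n with _ | n <;> simp [PowerSeries.coeff_C]
  simp [evenEmbedding, h, PowerSeries.expand_C]

lemma C_pi_sq_mul_evenEmbedding_X : C (4 * Real.pi ^ 2) * evenEmbedding X = -X ^ 2 := by
  have h : 4 * Real.pi ^ 2 * evenScale = -1 := by linarith [neg_pi_sq_mul_evenScale]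
  have hX : evenEmbedding X = C evenScale * X ^ 2 := by
    simp [evenEmbedding, PowerSeries.rescale_X, PowerSeries.expand_C, PowerSeries.expand_X]
  rw [hX, ← mul_assoc, ← map_mul, h, map_neg, map_one, neg_one_mul]

/-- The power series in `v` of `sin (π √v) / (π √v)`. -/
def sincSeries : ℝ⟦X⟧ := PowerSeries.mk fun m => (-Real.pi ^ 2) ^ m / ((2 * m + 1)! : ℝ)

/-- The power series in `v` of `π √v / sin (π √v)`. -/
def cscSeries : ℝ⟦X⟧ := sincSeries⁻¹

/-- The power series in `v` of `sin (π √v / 2) / (π √v / 2)`. -/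
def sincHalfSeries : ℝ⟦X⟧ := rescale (1 / 4) sincSeries

/-- The power series in `v` of `(π √v / 2) / sin (π √v / 2)`. -/
def cscHalfSeries : ℝ⟦X⟧ := rescale (1 / 4) cscSeries

lemma constantCoeff_sincSeries : constantCoeff sincSeries = 1 := by
  rw [← PowerSeries.coeff_zero_eq_constantCoeff_apply]
  simp [sincSeries]

lemma sincSeries_mul_cscSeries : sincSeries * cscSeries = 1 :=
  PowerSeries.mul_inv_cancel _ (by rw [constantCoeff_sincSeries]; exact one_ne_zero)

lemma sincHalfSeries_mul_cscHalfSeries : sincHalfSeries * cscHalfSeries = 1 := by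
  rw [sincHalfSeries, cscHalfSeries, ← map_mul, sincSeries_mul_cscSeries, map_one]

lemma X_mul_evenEmbedding_sincSeries :
    X * evenEmbedding sincSeries = expSeries (1 / 2) - expSeries (-(1 / 2)) := by
  refine ext_even_odd (fun m => ?_) fun m => ?_
  · rw [map_sub, coeff_expSeries, coeff_expSeries, (even_two_mul m).neg_pow, sub_self]
    rcases m with _ | m
    · simp
    · rw [show 2 * (m + 1) = 2 * m + 1 + 1 by ring, PowerSeries.coeff_succ_X_mul,
        coeff_evenEmbedding_odd]
  · rw [PowerSeries.coeff_succ_X_mul, coeff_evenEmbedding_even, map_sub, coeff_expSeries,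
      coeff_expSeries, (odd_two_mul_add_one m).neg_pow, sincSeries, PowerSeries.coeff_mk,
      mul_div_left_comm, ← mul_div_assoc, ← mul_pow, neg_pi_sq_mul_evenScale,
      pow_succ (1 / 2 : ℝ) (2 * m), pow_mul]
    ring

lemma X_mul_evenEmbedding_sincHalfSeries :
    X * evenEmbedding sincHalfSeries = 2 * (expSeries (1 / 4) - expSeries (-(1 / 4))) := by
  have h := congrArg (fun p => C 2 * rescale (1 / 2) p) X_mul_evenEmbedding_sincSeries
  simp only [map_mul, map_sub, PowerSeries.rescale_X, rescale_evenEmbedding,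
    rescale_expSeries] at h
  rw [← mul_assoc, ← mul_assoc, ← map_mul] at h
  norm_num at h
  simpa [sincHalfSeries, map_ofNat] using h

lemma expSeries_mul_expSeries_neg (c : ℝ) : expSeries c * expSeries (-c) = 1 := by
  rw [← expSeries_add, add_neg_cancel, expSeries_zero]

-- `exp (t / 4) = cosh (t / 4) + sinh (t / 4)`, where
-- `cosh (t / 4) = sinh (t / 2) / (2 sinh (t / 4))`.
lemma expSeries_one_quarter_eq :
    expSeries (1 / 4) = evenEmbedding cscHalfSeries * evenEmbedding sincSeries +
      C (1 / 4) * X * evenEmbedding sincHalfSeries := by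
  have hexp (c : ℝ) : expSeries (2 * c) = expSeries c ^ 2 := by rw [two_mul, expSeries_add, sq]
  have hS := X_mul_evenEmbedding_sincSeries
  rw [show (1 / 2 : ℝ) = 2 * (1 / 4) by norm_num, ← mul_neg, hexp, hexp] at hS
  have hH := X_mul_evenEmbedding_sincHalfSeries
  have hHA : evenEmbedding sincHalfSeries * evenEmbedding cscHalfSeries = 1 := by
    rw [← map_mul, sincHalfSeries_mul_cscHalfSeries, map_one]
  have hq : 4 * (C (1 / 4) : ℝ⟦X⟧) = 1 := by
    rw [← map_ofNat C 4, ← map_mul]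
    norm_num
  generalize evenEmbedding sincHalfSeries = H at *
  generalize evenEmbedding cscHalfSeries = A at *
  generalize expSeries (1 / 4) = E at *
  generalize expSeries (-(1 / 4)) = F at *
  refine mul_left_cancel₀ PowerSeries.X_ne_zero ?_
  linear_combination -X * E * hHA + A * E * hH - A * hS + C (1 / 4) * X ^ 2 * H * hHA -
    C (1 / 4) * A * (X * H + 2 * (E - F)) * hH - A * (E - F) ^ 2 * hq

/-! ### The Legendre series -/

section

variable {α : ℕ → ℝ} {W : ℝ⟦X⟧}

/-- `e ^ (t / 4) φ t`, where `φ` is the Borel transform of `termSeries α`. The exponential factor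
makes it an even function of `t`. -/
def symmetricSeries (α : ℕ → ℝ) : ℝ⟦X⟧ := expSeries (1 / 4) * borelTransform (termSeries α)

lemma IsLandauExpansion.symmetricSeries_ode (hα : IsLandauExpansion α) :
    euler (evenEmbedding sincSeries * euler (symmetricSeries α)) =
      evenEmbedding (C (Real.pi ^ 2 / 4) * (X * sincSeries)) * symmetricSeries α := by
  have hφ := hα.borelTransform_termSeries_ode
  have hE : expSeries (1 / 2) = expSeries (1 / 4) ^ 2 := by
    rw [sq, ← expSeries_add]
    norm_num
  have hF : expSeries (-(1 / 2)) = expSeries (-1) * expSeries (1 / 4) ^ 2 := by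
    rw [← hE, ← expSeries_add]
    norm_num
  have hhalf : (C (1 / 2) : ℝ⟦X⟧) = 2 * C (1 / 4) := by
    rw [← map_ofNat C 2, ← map_mul]
    norm_num
  have hquarter : 4 * (C (1 / 4) : ℝ⟦X⟧) = 1 := by
    rw [← map_ofNat C 4, ← map_mul]
    norm_num
  have hpi : (C (Real.pi ^ 2 / 4) : ℝ⟦X⟧) = C (1 / 4) ^ 2 * C (4 * Real.pi ^ 2) := by
    rw [← map_pow, ← map_mul]
    congr 1
    ring
  have hX := C_pi_sq_mul_evenEmbedding_X
  have hS := X_mul_evenEmbedding_sincSeries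
  rw [euler_apply, euler_apply, mul_left_comm, ← mul_assoc X, hS, symmetricSeries,
    map_mul evenEmbedding, map_mul evenEmbedding, evenEmbedding_C, hpi]
  simp only [Derivation.leibniz, map_add, map_sub, derivative_expSeries, smul_eq_mul, map_neg,
    neg_mul, PowerSeries.derivative_C, mul_zero, add_zero]
  rw [hE, hF] at hS
  rw [hE, hF, hhalf]
  generalize expSeries (1 / 4) = E at *
  generalize expSeries (-1) = e at *
  generalize borelTransform (termSeries α) = p at *
  generalize d⁄dX ℝ (d⁄dX ℝ p) = p'' at *
  generalize d⁄dX ℝ p = p' at *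
  generalize evenEmbedding X = x at *
  generalize evenEmbedding sincSeries = S at *
  linear_combination -X * E ^ 3 * hφ + X * E ^ 3 * (p' + C (1 / 4) * p) * hquarter -
    C (1 / 4) ^ 2 * S * E * p * hX + X * E * C (1 / 4) ^ 2 * p * hS

lemma IsLandauExpansion.rescale_neg_one_symmetricSeries (hα : IsLandauExpansion α) :
    rescale (-1) (symmetricSeries α) = symmetricSeries α := by
  have hev (p : ℝ⟦X⟧) : rescale (-1) (evenEmbedding p) = evenEmbedding p := by
    simp [rescale_evenEmbedding]
  have hψ := hα.symmetricSeries_ode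
  have hψ' := congrArg (rescale (-1)) hψ
  rw [← euler_rescale, map_mul (rescale (-1)), map_mul (rescale (-1)), ← euler_rescale,
    hev, hev] at hψ'
  refine sub_eq_zero.1 (eq_zero_of_euler_ode (S := evenEmbedding sincSeries)
    (r := evenEmbedding (C (Real.pi ^ 2 / 4) * (X * sincSeries))) ?_ ?_ ?_ ?_)
  · rw [constantCoeff_evenEmbedding, constantCoeff_sincSeries]
    exact one_ne_zero
  · simp [constantCoeff_evenEmbedding]
  · simp only [map_sub, ← PowerSeries.coeff_zero_eq_constantCoeff_apply,
      PowerSeries.coeff_rescale, pow_zero, one_mul, sub_self]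
  · rw [map_sub, mul_sub, map_sub, hψ, hψ', mul_sub]

/-- `W` is the power series in `v` of the Legendre function `P_{-1/2} (cos (π √v))`, characterised
by its differential equation and initial value. -/
structure IsLegendreSeries (W : ℝ⟦X⟧) : Prop where
  constantCoeff_eq : constantCoeff W = 1
  ode : euler (sincSeries * euler W) = C (Real.pi ^ 2 / 16) * (X * (sincSeries * W))

lemma expSeries_mul_symmetricSeries (α : ℕ → ℝ) :
    expSeries (1 / 4) * symmetricSeries α = evenEmbedding sincSeries *
      (1 - X * borelTransform (coeffSeries α)) := by
  have h := X_mul_borelTransform_termSeries α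
  have h1 : expSeries (1 / 4) * expSeries (1 / 4) = expSeries (1 / 2) := by
    rw [← expSeries_add]
    norm_num
  have h2 : expSeries (1 / 2) * expSeries (-1) = expSeries (-(1 / 2)) := by
    rw [← expSeries_add]
    norm_num
  refine mul_left_cancel₀ PowerSeries.X_ne_zero ?_
  rw [← mul_assoc X (evenEmbedding _), X_mul_evenEmbedding_sincSeries, symmetricSeries,
    ← mul_assoc (expSeries _), h1, ← h2]
  linear_combination expSeries (1 / 2) * h

lemma IsLandauExpansion.exists_isLegendreSeries (hα : IsLandauExpansion α) :
    ∃ W, IsLegendreSeries W ∧ evenEmbedding W = symmetricSeries α := by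
  obtain ⟨W, hW⟩ := exists_evenEmbedding_eq hα.rescale_neg_one_symmetricSeries
  refine ⟨W, ⟨?_, evenEmbedding_injective ?_⟩, hW⟩
  · have h := congrArg constantCoeff (expSeries_mul_symmetricSeries α)
    simpa [constantCoeff_expSeries, ← hW, constantCoeff_evenEmbedding,
      constantCoeff_sincSeries] using h
  · have h := hα.symmetricSeries_ode
    rw [← hW, euler_evenEmbedding, mul_left_comm, euler_C_mul, ← map_mul, euler_evenEmbedding,
      ← mul_assoc, ← map_mul, ← map_mul] at h
    have hpi : (Real.pi ^ 2 / 4) = 2 * 2 * (Real.pi ^ 2 / 16) := by ring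
    rw [hpi, map_mul C (2 * 2), mul_assoc (C _), mul_assoc (C _), map_mul evenEmbedding (C _),
      evenEmbedding_C, map_mul C, mul_assoc (C 2)] at h
    have h2 : (C 2 : ℝ⟦X⟧) ≠ 0 := by simp
    rw [← mul_assoc X]
    exact mul_left_cancel₀ h2 (mul_left_cancel₀ h2 (by rw [h, mul_assoc, mul_assoc]))

lemma one_sub_X_mul_borelTransform (hW : evenEmbedding W = symmetricSeries α) :
    1 - X * borelTransform (coeffSeries α) =
      evenEmbedding (cscHalfSeries * W) +
        C (1 / 4) * (X * evenEmbedding (sincHalfSeries * cscSeries * W)) := by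
  have h := expSeries_mul_symmetricSeries α
  have h1 := congrArg evenEmbedding sincSeries_mul_cscSeries
  rw [map_mul, map_one] at h1
  rw [← hW, expSeries_one_quarter_eq] at h
  simp only [map_mul]
  linear_combination -evenEmbedding cscSeries * h -
    (1 - X * borelTransform (coeffSeries α) - evenEmbedding cscHalfSeries * evenEmbedding W) * h1

lemma coeff_succ_one_sub_X_mul_borelTransform (α : ℕ → ℝ) (k : ℕ) :
    coeff (k + 1) (1 - X * borelTransform (coeffSeries α)) = -(α (k + 1) / (k ! : ℝ)) := by
  rw [map_sub, PowerSeries.coeff_one, if_neg k.succ_ne_zero, PowerSeries.coeff_succ_X_mul,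
    coeff_borelTransform]
  simp [coeffSeries]

lemma expansion_coeff_even (hW : evenEmbedding W = symmetricSeries α) {k : ℕ} (hk : 1 ≤ k) :
    α (2 * k) = (-1) ^ (k + 1) * (((2 * k - 1)! : ℝ) / (2 * Real.pi) ^ (2 * k)) *
      coeff k (cscHalfSeries * W) := by
  have h := congrArg (coeff (2 * k)) (one_sub_X_mul_borelTransform hW)
  obtain ⟨k, rfl⟩ := Nat.exists_eq_add_of_le' hk
  rw [map_add, PowerSeries.coeff_C_mul, coeff_evenEmbedding_even, evenScale_pow, mul_add_one 2 k,
    coeff_succ_one_sub_X_mul_borelTransform, PowerSeries.coeff_succ_X_mul, coeff_evenEmbedding_odd,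
    mul_zero, add_zero] at h
  rw [mul_add_one 2 k, show 2 * k + 2 - 1 = 2 * k + 1 by omega]
  have hfact : ((2 * k + 1)! : ℝ) ≠ 0 := by positivity
  linear_combination -((2 * k + 1)! : ℝ) * h - α (2 * k + 2) * div_self hfact

lemma expansion_coeff_odd (hW : evenEmbedding W = symmetricSeries α) (k : ℕ) :
    α (2 * k + 1) = (-1) ^ (k + 1) * (((2 * k)! : ℝ) / (2 * Real.pi) ^ (2 * k)) *
      (coeff k (sincHalfSeries * cscSeries * W) / 4) := by
  have h := congrArg (coeff (2 * k + 1)) (one_sub_X_mul_borelTransform hW)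
  rw [map_add, PowerSeries.coeff_C_mul, coeff_evenEmbedding_odd,
    coeff_succ_one_sub_X_mul_borelTransform, PowerSeries.coeff_succ_X_mul,
    coeff_evenEmbedding_even, evenScale_pow, zero_add] at h
  have hfact : ((2 * k)! : ℝ) ≠ 0 := by positivity
  rw [pow_succ]
  linear_combination -((2 * k)! : ℝ) * h - α (2 * k + 1) * div_self hfact

end

/-! ### Decay of coefficients -/

section Decay

variable {p q : ℝ⟦X⟧} {s t : ℝ}

/-- The coefficients of `p` are `O(n ^ (-s))`. -/
def HasDecay (p : ℝ⟦X⟧) (s : ℝ) : Prop :=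
  (fun n => coeff n p) =O[atTop] fun n : ℕ => ((n : ℝ) + 1) ^ (-s)

/-- The coefficients of `p` decay faster than any power of the index. -/
def RapidDecay (p : ℝ⟦X⟧) : Prop := ∀ s, HasDecay p s

lemma hasDecay_iff :
    HasDecay p s ↔ ∃ K, ∀ n : ℕ, |coeff n p| ≤ K * ((n : ℝ) + 1) ^ (-s) := by
  have hpos (n : ℕ) : (0 : ℝ) < ((n : ℝ) + 1) ^ (-s) := by positivity
  rw [HasDecay, isBigO_nat_atTop_iff fun n h => absurd h (hpos n).ne']
  simp only [Real.norm_eq_abs, abs_of_pos (hpos _)]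

lemma sum_range_inv_sq_le (n m : ℕ) :
    ∑ j ∈ Finset.range m, (((j + (n + 1) : ℕ) + 1 : ℝ) ^ 2)⁻¹ ≤ ((n : ℝ) + 1)⁻¹ := by
  have h := sum_Ioc_inv_sq_le_sub (α := ℝ) n.succ_ne_zero (Nat.le_add_left (n + 1) m)
  rw [← Finset.Ico_add_one_add_one_eq_Ioc, ← Finset.sum_Ico_add', Finset.sum_Ico_eq_sum_range,
    Nat.add_sub_cancel] at h
  refine le_of_eq_of_le (Finset.sum_congr rfl fun j _ => ?_)
    (h.trans ((sub_le_self _ (by positivity)).trans_eq ?_))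
  · push_cast
    ring
  · push_cast
    rfl

lemma summable_rpow_neg (hs : 1 < s) : Summable fun n : ℕ => ((n : ℝ) + 1) ^ (-s) := by
  simpa using (summable_nat_add_iff 1).2 (Real.summable_nat_rpow.2 (neg_lt_neg hs))

lemma isBigO_rpow_neg (h : s ≤ t) :
    (fun n : ℕ => ((n : ℝ) + 1) ^ (-t)) =O[atTop] fun n : ℕ => ((n : ℝ) + 1) ^ (-s) :=
  .of_bound' <| .of_forall fun n => by
    simp only [Real.norm_of_nonneg (Real.rpow_nonneg n.cast_add_one_pos.le _)]
    exact Real.rpow_le_rpow_of_exponent_le (by linarith [n.cast_nonneg (α := ℝ)]) (neg_le_neg h)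

lemma rpow_neg_add_one_le (hs : 1 ≤ s) {n j : ℕ} (hj : n ≤ j) :
    ((j : ℝ) + 1) ^ (-(s + 1)) ≤ ((n : ℝ) + 1) ^ (1 - s) * (((j : ℝ) + 1) ^ 2)⁻¹ := by
  have hsplit : ((j : ℝ) + 1) ^ (-(s + 1)) = ((j : ℝ) + 1) ^ (1 - s) * (((j : ℝ) + 1) ^ 2)⁻¹ := by
    rw [← Real.rpow_natCast, ← Real.rpow_neg j.cast_add_one_pos.le,
      ← Real.rpow_add j.cast_add_one_pos]
    congr 1
    push_cast
    ring
  have hnj : (n : ℝ) + 1 ≤ (j : ℝ) + 1 := by exact_mod_cast Nat.succ_le_succ hj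
  rw [hsplit]
  exact mul_le_mul_of_nonneg_right
    (Real.rpow_le_rpow_of_nonpos n.cast_add_one_pos hnj (by linarith)) (by positivity)

namespace HasDecay

lemma mono (hp : HasDecay p t) (h : s ≤ t) : HasDecay p s :=
  hp.trans (isBigO_rpow_neg h)

lemma add (hp : HasDecay p s) (hq : HasDecay q s) : HasDecay (p + q) s := by
  simpa only [HasDecay, map_add] using IsBigO.add hp hq

lemma sub (hp : HasDecay p s) (hq : HasDecay q s) : HasDecay (p - q) s := by
  simpa only [HasDecay, map_sub] using IsBigO.sub hp hq

lemma C_mul (hp : HasDecay p s) (c : ℝ) : HasDecay (C c * p) s := by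
  simpa only [HasDecay, PowerSeries.coeff_C_mul] using IsBigO.const_mul_left hp c

lemma summable (hp : HasDecay p s) (hs : 1 < s) : Summable fun n => |coeff n p| :=
  summable_of_isBigO_nat (summable_rpow_neg hs) hp.abs_left

-- The tail is compared with `∑ 1 / j ^ 2`, whose tails telescope.
lemma isBigO_sum_sub_tsum (hp : HasDecay p (s + 1)) (hs : 1 ≤ s) :
    (fun n => ∑ j ∈ Finset.range (n + 1), coeff j p - ∑' j, coeff j p) =O[atTop]
      fun n : ℕ => ((n : ℝ) + 1) ^ (-s) := by
  obtain ⟨K, hK⟩ := hasDecay_iff.1 hp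
  have hK0 : 0 ≤ K := by simpa using (abs_nonneg _).trans (hK 0)
  have hsum := hp.summable (by linarith)
  have htail (n m : ℕ) : ∑ j ∈ Finset.range m, ‖coeff (j + (n + 1)) p‖ ≤
      K * ((n : ℝ) + 1) ^ (-s) := by
    have hn : (0 : ℝ) < (n : ℝ) + 1 := n.cast_add_one_pos
    have hterm (j : ℕ) : ‖coeff (j + (n + 1)) p‖ ≤
        K * ((n : ℝ) + 1) ^ (1 - s) * (((j + (n + 1) : ℕ) + 1 : ℝ) ^ 2)⁻¹ :=
      (hK _).trans ((mul_le_mul_of_nonneg_left (rpow_neg_add_one_le hs (by omega)) hK0).trans_eq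
        (mul_assoc _ _ _).symm)
    calc ∑ j ∈ Finset.range m, ‖coeff (j + (n + 1)) p‖
        ≤ K * ((n : ℝ) + 1) ^ (1 - s) * ∑ j ∈ Finset.range m,
            (((j + (n + 1) : ℕ) + 1 : ℝ) ^ 2)⁻¹ := by
          rw [Finset.mul_sum]
          exact Finset.sum_le_sum fun j _ => hterm j
      _ ≤ K * ((n : ℝ) + 1) ^ (1 - s) * ((n : ℝ) + 1)⁻¹ :=
          mul_le_mul_of_nonneg_left (sum_range_inv_sq_le n m) (by positivity)
      _ = K * ((n : ℝ) + 1) ^ (-s) := by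
          rw [mul_assoc, ← Real.rpow_neg_one, ← Real.rpow_add hn]
          congr 2
          ring
  refine IsBigO.of_bound K (Eventually.of_forall fun n => ?_)
  have hnorm : ‖∑' j, coeff (j + (n + 1)) p‖ ≤ ∑' j, ‖coeff (j + (n + 1)) p‖ :=
    norm_tsum_le_tsum_norm ((summable_nat_add_iff (n + 1)).2 hsum)
  rw [← hsum.of_abs.sum_add_tsum_nat_add (n + 1), sub_add_cancel_left, norm_neg,
    Real.norm_of_nonneg (Real.rpow_nonneg n.cast_add_one_pos.le _)]
  exact hnorm.trans (Real.tsum_le_of_sum_range_le (fun _ => norm_nonneg _) (htail n))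

end HasDecay

namespace RapidDecay

lemma summable_mul_rpow (hp : RapidDecay p) (s : ℝ) :
    Summable fun i : ℕ => |coeff i p| * ((i : ℝ) + 1) ^ s := by
  refine summable_of_isBigO_nat (summable_rpow_neg one_lt_two)
    (((hp (s + 2)).abs_left.mul (isBigO_refl _ _)).congr_right ?_)
  intro i
  rw [← Real.rpow_add i.cast_add_one_pos]
  congr 1
  ring

lemma abs_coeff_mul_le (hp : RapidDecay p) (hs : 0 ≤ s) {B : ℝ} (hB : 0 ≤ B) {n : ℕ}
    (hq : ∀ j ≤ n, |coeff j q| ≤ B * ((j : ℝ) + 1) ^ (-s)) :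
    |coeff n (p * q)| ≤ (∑' i, |coeff i p| * ((i : ℝ) + 1) ^ s) * B * ((n : ℝ) + 1) ^ (-s) := by
  have hweight (i j : ℕ) (hij : i + j = n) :
      ((j : ℝ) + 1) ^ (-s) ≤ ((i : ℝ) + 1) ^ s * ((n : ℝ) + 1) ^ (-s) := by
    have hle : (n : ℝ) + 1 ≤ ((i : ℝ) + 1) * ((j : ℝ) + 1) := by
      rw [← hij]
      push_cast
      nlinarith [mul_nonneg (i.cast_nonneg (α := ℝ)) (j.cast_nonneg (α := ℝ))]
    have h := Real.rpow_le_rpow_of_nonpos n.cast_add_one_pos hle (neg_nonpos.2 hs)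
    rw [Real.mul_rpow i.cast_add_one_pos.le j.cast_add_one_pos.le,
      Real.rpow_neg i.cast_add_one_pos.le, inv_mul_le_iff₀ (by positivity)] at h
    exact h
  rw [PowerSeries.coeff_mul]
  calc |∑ x ∈ Finset.HasAntidiagonal.antidiagonal n, coeff x.1 p * coeff x.2 q|
      ≤ ∑ x ∈ Finset.HasAntidiagonal.antidiagonal n,
          |coeff x.1 p| * ((x.1 : ℝ) + 1) ^ s * (B * ((n : ℝ) + 1) ^ (-s)) := by
        refine (Finset.abs_sum_le_sum_abs _ _).trans (Finset.sum_le_sum fun x hx => ?_)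
        rw [Finset.HasAntidiagonal.mem_antidiagonal] at hx
        rw [abs_mul, mul_assoc]
        refine mul_le_mul_of_nonneg_left ((hq x.2 (by omega)).trans ?_) (abs_nonneg _)
        rw [mul_left_comm]
        exact mul_le_mul_of_nonneg_left (hweight _ _ hx) hB
    _ = (∑ i ∈ Finset.range (n + 1), |coeff i p| * ((i : ℝ) + 1) ^ s) *
          (B * ((n : ℝ) + 1) ^ (-s)) := by
        rw [Finset.Nat.sum_antidiagonal_eq_sum_range_succ_mk, Finset.sum_mul]
    _ ≤ (∑' i, |coeff i p| * ((i : ℝ) + 1) ^ s) * B * ((n : ℝ) + 1) ^ (-s) := by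
        rw [mul_assoc]
        exact mul_le_mul_of_nonneg_right
          ((hp.summable_mul_rpow s).sum_le_tsum _ fun i _ => by positivity) (by positivity)

lemma mul_hasDecay (hp : RapidDecay p) (hs : 0 ≤ s) (hq : HasDecay q s) :
    HasDecay (p * q) s := by
  obtain ⟨B, hB⟩ := hasDecay_iff.1 hq
  have hB0 : 0 ≤ B := by simpa using (abs_nonneg _).trans (hB 0)
  exact hasDecay_iff.2 ⟨_, fun n => hp.abs_coeff_mul_le hs hB0 fun j _ => hB j⟩

-- Summation by parts: `p = p(1) + (1 - X) r`, where the coefficients of `r` are the tails of `p`.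
lemma hasDecay_mul_sub (hp : RapidDecay p) (hs : 0 ≤ s) (hq : HasDecay ((1 - X) * q) s) :
    HasDecay (p * q - C (∑' i, coeff i p) * q) s := by
  set r : ℝ⟦X⟧ := PowerSeries.mk fun n =>
    ∑ j ∈ Finset.range (n + 1), coeff j p - ∑' j, coeff j p
  have hr : RapidDecay r := fun t => by
    refine HasDecay.mono (t := max t 1) ?_ (le_max_left t 1)
    simpa only [HasDecay, r, PowerSeries.coeff_mk] using
      (hp (max t 1 + 1)).isBigO_sum_sub_tsum (le_max_right t 1)
  have hpr : p - C (∑' i, coeff i p) = (1 - X) * r := by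
    ext n
    rw [sub_mul, one_mul, map_sub, map_sub]
    rcases n with _ | n
    · simp [r]
    · rw [PowerSeries.coeff_succ_X_mul]
      simp only [r, PowerSeries.coeff_mk, Finset.sum_range_succ _ (n + 1), PowerSeries.coeff_C,
        n.succ_ne_zero, if_false]
      ring
  rw [← sub_mul, hpr, mul_comm (1 - X), mul_assoc]
  exact hr.mul_hasDecay hs hq

end RapidDecay

lemma hasDecay_zero_iff :
    HasDecay p 0 ↔ (fun n => coeff n p) =O[atTop] fun _ : ℕ => (1 : ℝ) := by
  simp [HasDecay]

lemma isBigO_pow_rpow_neg {r : ℝ} (hr0 : 0 < r) (hr1 : r < 1) (s : ℝ) :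
    (fun n : ℕ => r ^ n) =O[atTop] fun n : ℕ => ((n : ℝ) + 1) ^ (-s) := by
  obtain ⟨k, hk⟩ := exists_nat_ge s
  have hlim : (fun n : ℕ => ((n + 1 : ℕ) : ℝ) ^ k * r ^ (n + 1)) =O[atTop] fun _ => (1 : ℝ) :=
    ((tendsto_pow_const_mul_const_pow_of_lt_one k hr0.le hr1).comp
      (tendsto_add_atTop_nat 1)).isBigO_one ℝ
  refine ((hlim.mul (isBigO_rpow_neg hk)).const_mul_left r⁻¹).congr (fun n => ?_) fun n => one_mul _
  have : (n : ℝ) + 1 ≠ 0 := n.cast_add_one_ne_zero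
  rw [Real.rpow_neg n.cast_add_one_pos.le, Real.rpow_natCast]
  push_cast
  field_simp
  ring

lemma RapidDecay.of_isBigO_pow {r : ℝ} (hr0 : 0 < r) (hr1 : r < 1)
    (hp : (fun n => coeff n p) =O[atTop] fun n : ℕ => r ^ n) : RapidDecay p :=
  fun s => hp.trans (isBigO_pow_rpow_neg hr0 hr1 s)

lemma HasDecay.rapidDecay_rescale (hp : HasDecay p s) {c : ℝ} (hc : |c| < 1) :
    RapidDecay (rescale c p) := by
  intro t
  obtain ⟨r, hcr, hr1⟩ := exists_between hc
  have hpow : (fun n : ℕ => c ^ n) =O[atTop] fun n : ℕ => r ^ n :=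
    .of_bound' <| .of_forall fun n => by
      rw [norm_pow, Real.norm_eq_abs]
      exact (pow_le_pow_left₀ (abs_nonneg c) hcr.le n).trans (le_abs_self _)
  have hr := hpow.trans (isBigO_pow_rpow_neg ((abs_nonneg c).trans_lt hcr) hr1 (t - s))
  refine (hr.mul hp).congr (fun n => (PowerSeries.coeff_rescale _ _ _).symm) fun n => ?_
  rw [← Real.rpow_add n.cast_add_one_pos]
  congr 1
  ring

lemma rapidDecay_coe (P : Polynomial ℝ) : RapidDecay (P : ℝ⟦X⟧) := fun s => by
  refine IsBigO.of_bound 0 ((eventually_gt_atTop P.natDegree).mono fun n hn => ?_)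
  rw [Polynomial.coeff_coe, Polynomial.coeff_eq_zero_of_natDegree_lt hn, norm_zero, zero_mul]

lemma rapidDecay_C (c : ℝ) : RapidDecay (C c : ℝ⟦X⟧) := by
  simpa only [Polynomial.coe_C] using rapidDecay_coe (.C c)

lemma rapidDecay_X : RapidDecay (X : ℝ⟦X⟧) := by
  simpa only [Polynomial.coe_X] using rapidDecay_coe .X

lemma rapidDecay_one_sub_X : RapidDecay (1 - X : ℝ⟦X⟧) := by
  simpa only [Polynomial.coe_sub, Polynomial.coe_one, Polynomial.coe_X] using
    rapidDecay_coe (1 - .X)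

lemma HasDecay.of_euler (hp : HasDecay (euler p) s) : HasDecay p (s + 1) := by
  have hinv : (fun n : ℕ => (n : ℝ)⁻¹) =O[atTop] fun n : ℕ => ((n : ℝ) + 1)⁻¹ := by
    refine IsBigO.of_bound 2 ((eventually_ge_atTop 1).mono fun n hn => ?_)
    have hn' : (1 : ℝ) ≤ n := by exact_mod_cast hn
    rw [norm_inv, norm_inv, Real.norm_natCast, Real.norm_of_nonneg n.cast_add_one_pos.le,
      ← div_eq_mul_inv, inv_eq_one_div, div_le_div_iff₀ (by positivity) (by positivity)]
    linarith
  refine (hinv.mul hp).congr' ((eventually_ne_atTop 0).mono fun n hn => ?_)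
    (.of_forall fun n => ?_)
  · dsimp only
    rw [coeff_euler, inv_mul_cancel_left₀ (Nat.cast_ne_zero.2 hn)]
  · dsimp only
    rw [← Real.rpow_neg_one, ← Real.rpow_add n.cast_add_one_pos]
    congr 1
    ring

end Decay

/-! ### The coefficients of the cosecant -/

lemma evenEmbedding_cscSeries :
    evenEmbedding cscSeries =
      2 * rescale (1 / 2) (bernoulliPowerSeries ℝ) - bernoulliPowerSeries ℝ := by
  have hB := bernoulliPowerSeries_mul_exp_sub_one ℝ
  have hH := congrArg (rescale (1 / 2 : ℝ)) hB
  rw [map_mul, map_sub, map_one, PowerSeries.rescale_X] at hH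
  change _ * (expSeries (1 / 2) - 1) = _ at hH
  have hexp : exp ℝ = expSeries (1 / 2) ^ 2 := by
    rw [sq, ← expSeries_add]
    norm_num [expSeries]
  have htwo : (2 : ℝ⟦X⟧) * C (1 / 2) = 1 := by
    rw [← map_ofNat C 2, ← map_mul]
    norm_num
  have hneg := expSeries_mul_expSeries_neg (1 / 2)
  have hS := X_mul_evenEmbedding_sincSeries
  have hinv := congrArg evenEmbedding sincSeries_mul_cscSeries
  rw [map_mul, map_one] at hinv
  rw [hexp] at hB
  generalize bernoulliPowerSeries ℝ = B at *
  generalize rescale (1 / 2) B = H at *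
  generalize expSeries (1 / 2) = a at *
  generalize expSeries (-(1 / 2)) = b at *
  have hmul : (2 * H - B) * evenEmbedding sincSeries = 1 := by
    have h : (2 * H - B) * (a ^ 2 - 1) = X * a := by
      linear_combination 2 * (a + 1) * hH - hB + X * (a + 1) * htwo
    refine mul_left_cancel₀ PowerSeries.X_ne_zero ?_
    linear_combination (2 * H - B) * hS + b * h + (X - (2 * H - B) * a) * hneg
  linear_combination (2 * H - B) * hinv - evenEmbedding cscSeries * hmul

lemma coeff_cscSeries {m : ℕ} (hm : m ≠ 0) :
    coeff m cscSeries = 2 * (1 - 2 * (1 / 4) ^ m) * ∑' n : ℕ, 1 / (n : ℝ) ^ (2 * m) := by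
  have hscale : evenScale ^ m * ((-1) ^ (m + 1) * 2 ^ (2 * m - 1) * Real.pi ^ (2 * m)) =
      -(1 / 2) := by
    have hsign : ((-1 : ℝ) ^ m) ^ 2 = 1 := by rw [pow_right_comm, neg_one_sq, one_pow]
    have htwo : (2 : ℝ) ^ (2 * m) = 2 * 2 ^ (2 * m - 1) := by
      rw [← pow_succ', Nat.sub_add_cancel (by omega)]
    have := Real.pi_pos
    rw [evenScale_pow, mul_pow, htwo]
    field_simp
    linear_combination -hsign
  have h := congrArg (coeff (2 * m)) evenEmbedding_cscSeries
  rw [coeff_evenEmbedding_even, ← map_ofNat C 2, map_sub, PowerSeries.coeff_C_mul,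
    PowerSeries.coeff_rescale, bernoulliPowerSeries, PowerSeries.coeff_mk, pow_mul (1 / 2 : ℝ),
    eq_ratCast] at h
  refine mul_left_cancel₀ (pow_ne_zero m evenScale_ne_zero) (h.trans ?_)
  rw [(hasSum_zeta_nat hm).tsum_eq, show ((1 / 2 : ℝ) ^ 2) = 1 / 4 by norm_num]
  push_cast
  linear_combination
    (-2 * (1 - 2 * (1 / 4) ^ m) * (bernoulli (2 * m) : ℝ) / ((2 * m)! : ℝ)) * hscale

lemma inv_pow_even_le {m n : ℕ} (hm : m ≠ 0) (hn : n ≠ 1) :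
    1 / (n : ℝ) ^ (2 * m) ≤ 4 * (1 / 4) ^ m * (1 / (n : ℝ) ^ 2) := by
  obtain ⟨m, rfl⟩ := Nat.exists_eq_succ_of_ne_zero hm
  rcases Nat.eq_zero_or_pos n with rfl | hpos
  · simp
  have hn2 : (2 : ℝ) ≤ n := by exact_mod_cast (by omega : 2 ≤ n)
  have hle : (4 : ℝ) ^ m ≤ (n : ℝ) ^ (2 * m) := by
    rw [pow_mul]
    exact pow_le_pow_left₀ (by norm_num) (by nlinarith) m
  have hrw : 4 * (1 / 4 : ℝ) ^ (m + 1) * (1 / (n : ℝ) ^ 2) = 1 / (4 ^ m * (n : ℝ) ^ 2) := by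
    rw [pow_succ, one_div_pow]
    field_simp
  rw [hrw, Nat.mul_succ, pow_add]
  gcongr

lemma isBigO_tsum_inv_pow_even_sub_one :
    (fun m : ℕ => ∑' n : ℕ, 1 / (n : ℝ) ^ (2 * m) - 1) =O[atTop] fun m => (1 / 4 : ℝ) ^ m := by
  refine IsBigO.of_bound (4 * ∑' n : ℕ, 1 / (n : ℝ) ^ 2)
    ((eventually_ne_atTop 0).mono fun m hm => ?_)
  have hsum : Summable fun n : ℕ => 1 / (n : ℝ) ^ (2 * m) :=
    Real.summable_one_div_nat_pow.2 (by omega)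
  have hsum2 : Summable fun n : ℕ => 1 / (n : ℝ) ^ 2 := Real.summable_one_div_nat_pow.2 one_lt_two
  have hnonneg (n : ℕ) : 0 ≤ if n = 1 then 0 else 1 / (n : ℝ) ^ (2 * m) := by positivity
  rw [hsum.tsum_eq_add_tsum_ite 1, Nat.cast_one, one_pow, div_one, add_sub_cancel_left,
    Real.norm_of_nonneg (tsum_nonneg hnonneg), Real.norm_of_nonneg (by positivity), mul_right_comm,
    ← tsum_mul_left]
  have hle (n : ℕ) : (if n = 1 then 0 else 1 / (n : ℝ) ^ (2 * m)) ≤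
      4 * (1 / 4) ^ m * (1 / (n : ℝ) ^ 2) := by
    split_ifs with hn
    · positivity
    · exact inv_pow_even_le hm hn
  have hmaj := hsum2.mul_left (4 * (1 / 4 : ℝ) ^ m)
  exact (hmaj.of_nonneg_of_le hnonneg hle).tsum_le_tsum hle hmaj

/-- The part of `cscSeries` that remains after its polar part `2 / (1 - v)` is removed. -/
def cscRemainder : ℝ⟦X⟧ := cscSeries - C 2 * PowerSeries.mk 1

lemma rapidDecay_cscRemainder : RapidDecay cscRemainder := by
  refine .of_isBigO_pow (r := 1 / 4) (by norm_num) (by norm_num) ?_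
  have hpow : (fun m : ℕ => (1 / 4 : ℝ) ^ m) =O[atTop] fun _ => (1 : ℝ) :=
    (tendsto_pow_atTop_nhds_zero_of_lt_one (by norm_num) (by norm_num)).isBigO_one ℝ
  have hzeta := isBigO_tsum_inv_pow_even_sub_one
  have hprod : (fun m : ℕ => (1 / 4 : ℝ) ^ m * (∑' n : ℕ, 1 / (n : ℝ) ^ (2 * m) - 1)) =O[atTop]
      fun m => (1 / 4 : ℝ) ^ m := by
    simpa only [one_mul] using hpow.mul hzeta
  refine (((hzeta.const_mul_left 2).sub (hprod.const_mul_left 4)).sub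
    ((isBigO_refl _ _).const_mul_left 4)).congr' ((eventually_ne_atTop 0).mono fun m hm => ?_) .rfl
  simp only [cscRemainder, map_sub, PowerSeries.coeff_C_mul, PowerSeries.coeff_mk, Pi.one_apply,
    coeff_cscSeries hm]
  ring

lemma coeff_mk_one_mul (q : ℝ⟦X⟧) (n : ℕ) :
    coeff n (PowerSeries.mk 1 * q) = ∑ j ∈ Finset.range (n + 1), coeff j q := by
  rw [mul_comm, PowerSeries.coeff_mul, Finset.Nat.sum_antidiagonal_eq_sum_range_succ_mk]
  simp

lemma cscSeries_mul (q : ℝ⟦X⟧) :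
    cscSeries * q = C 2 * (PowerSeries.mk 1 * q) + cscRemainder * q := by
  rw [cscRemainder]
  ring

lemma hasDecay_mk_one : HasDecay (PowerSeries.mk 1) 0 := hasDecay_zero_iff.2 <| by
  simpa only [PowerSeries.coeff_mk, Pi.one_apply] using isBigO_refl (fun _ : ℕ => (1 : ℝ)) atTop

lemma hasDecay_cscSeries : HasDecay cscSeries 0 := by
  simpa only [cscRemainder, sub_add_cancel] using
    (rapidDecay_cscRemainder 0).add (hasDecay_mk_one.C_mul 2)

lemma rapidDecay_sincSeries : RapidDecay sincSeries := by
  refine .of_isBigO_pow (r := 1 / 4) (by norm_num) (by norm_num) ?_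
  refine IsBigO.of_bound (Real.exp (2 * Real.pi)) (.of_forall fun m => ?_)
  have hfact : ((2 * m)! : ℝ) ≤ (2 * m + 1)! := by exact_mod_cast Nat.factorial_le (Nat.le_succ _)
  have := Real.pi_pos
  rw [sincSeries, PowerSeries.coeff_mk, norm_div, norm_pow, norm_neg,
    Real.norm_of_nonneg (sq_nonneg Real.pi), Real.norm_natCast,
    Real.norm_of_nonneg (by positivity), one_div_pow, mul_one_div, le_div_iff₀ (by positivity)]
  calc (Real.pi ^ 2) ^ m / ((2 * m + 1)! : ℝ) * 4 ^ m
      = (2 * Real.pi) ^ (2 * m) / ((2 * m + 1)! : ℝ) := by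
        rw [pow_mul (2 * Real.pi), mul_pow 2 Real.pi, mul_pow]
        ring
    _ ≤ (2 * Real.pi) ^ (2 * m) / ((2 * m)! : ℝ) := by gcongr
    _ ≤ Real.exp (2 * Real.pi) := Real.pow_div_factorial_le_exp _ (by positivity) _

lemma rapidDecay_sincHalfSeries : RapidDecay sincHalfSeries :=
  (rapidDecay_sincSeries 0).rapidDecay_rescale (by norm_num [abs_lt])

lemma rapidDecay_cscHalfSeries : RapidDecay cscHalfSeries :=
  hasDecay_cscSeries.rapidDecay_rescale (by norm_num [abs_lt])

/-! ### Evaluation of power series -/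

section Evaluation

variable {p q : ℝ⟦X⟧} {s t x : ℝ}

/-- The sum of the real power series `p` at `x`. -/
def evalSeries (p : ℝ⟦X⟧) (x : ℝ) : ℝ := ∑' n, coeff n p * x ^ n

lemma evalSeries_zero (p : ℝ⟦X⟧) : evalSeries p 0 = constantCoeff p := by
  rw [evalSeries, tsum_eq_single 0 fun n hn => by simp [hn]]
  simp

lemma evalSeries_C_mul (c : ℝ) (p : ℝ⟦X⟧) (x : ℝ) :
    evalSeries (C c * p) x = c * evalSeries p x := by
  simp only [evalSeries, PowerSeries.coeff_C_mul, mul_assoc, tsum_mul_left]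

lemma evalSeries_X_mul (p : ℝ⟦X⟧) (x : ℝ) : evalSeries (X * p) x = x * evalSeries p x := by
  rw [evalSeries, evalSeries, ← tsum_mul_left, ← Nat.succ_injective.tsum_eq]
  · refine tsum_congr fun n => ?_
    rw [Nat.succ_eq_add_one, PowerSeries.coeff_succ_X_mul]
    ring
  · intro n hn
    rcases n with _ | n
    · simp at hn
    · exact ⟨n, rfl⟩

lemma evalSeries_one_sub_X (x : ℝ) : evalSeries (1 - X) x = 1 - x := by
  rw [evalSeries, tsum_eq_sum (s := Finset.range 2) fun n hn => ?_]
  · simp [Finset.sum_range_succ, PowerSeries.coeff_X, PowerSeries.coeff_one, sub_eq_add_neg]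
  · have hn' : 1 < n := by simpa using hn
    rw [map_sub, PowerSeries.coeff_X, PowerSeries.coeff_one, if_neg (by omega), if_neg (by omega),
      sub_zero, zero_mul]

lemma tsum_coeff_rescale (c : ℝ) (p : ℝ⟦X⟧) :
    ∑' n, coeff n (rescale c p) = evalSeries p c := by
  simp only [evalSeries, PowerSeries.coeff_rescale, mul_comm]

namespace HasDecay

lemma derivative (hp : HasDecay p s) : HasDecay (d⁄dX ℝ p) (s - 1) := by
  have hratio : (fun n : ℕ => (1 + ((n : ℝ) + 1)⁻¹) ^ (-s)) =O[atTop] fun _ => (1 : ℝ) := by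
    have hlim := (tendsto_one_div_add_atTop_nhds_zero_nat (𝕜 := ℝ)).const_add 1
    simp only [one_div, add_zero] at hlim
    exact (hlim.rpow_const (p := -s) (.inl one_ne_zero)).isBigO_one ℝ
  refine ((hp.comp_tendsto (tendsto_add_atTop_nat 1)).mul
    (isBigO_refl (fun n : ℕ => (n : ℝ) + 1) _)).trans
    ((hratio.mul (isBigO_refl (fun n : ℕ => ((n : ℝ) + 1) ^ (-(s - 1))) _)).congr
      (fun n => ?_) fun n => one_mul _) |>.congr_left fun n => ?_
  · have hn : (0 : ℝ) < (n : ℝ) + 1 := n.cast_add_one_pos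
    rw [neg_sub, sub_eq_neg_add, Real.rpow_add_one hn.ne', ← mul_assoc,
      ← Real.mul_rpow (by positivity) hn.le, add_mul, one_mul, inv_mul_cancel₀ hn.ne']
    simp
  · rw [PowerSeries.coeff_derivative]
    rfl

lemma summable_norm_mul_pow (hp : HasDecay p s) (hx : |x| < 1) :
    Summable fun n => ‖coeff n p * x ^ n‖ := by
  simpa only [PowerSeries.coeff_rescale, mul_comm, Real.norm_eq_abs] using
    (hp.rapidDecay_rescale hx 2).summable one_lt_two

lemma hasDerivAt_evalSeries (hp : HasDecay p s) (hx : |x| < 1) :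
    HasDerivAt (evalSeries p) (evalSeries (d⁄dX ℝ p) x) x := by
  obtain ⟨y, hxy, hy⟩ := exists_between hx
  have hy0 : 0 < y := (abs_nonneg x).trans_lt hxy
  have hterm (n : ℕ) {z : ℝ} (hz : |z| ≤ y) :
      ‖coeff n p * (n * z ^ (n - 1))‖ ≤ |coeff n p| * (n * y ^ (n - 1)) := by
    rw [norm_mul, norm_mul, norm_pow, Real.norm_natCast, Real.norm_eq_abs, Real.norm_eq_abs]
    gcongr
  have hmaj : Summable fun n : ℕ => |coeff n p| * (n * y ^ (n - 1)) := by
    have hsum := hp.derivative.summable_norm_mul_pow (x := y) (by rwa [abs_of_pos hy0])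
    refine (summable_nat_add_iff 1).1 (hsum.congr fun n => ?_)
    rw [PowerSeries.coeff_derivative, norm_mul, norm_mul, norm_pow, Real.norm_of_nonneg hy0.le,
      Real.norm_eq_abs, Real.norm_of_nonneg n.cast_add_one_pos.le]
    push_cast
    ring
  have hderiv := hasDerivAt_tsum_of_isPreconnected (g := fun n x => coeff n p * x ^ n)
    (t := Metric.ball 0 y) (y₀ := 0) (y := x) hmaj Metric.isOpen_ball
    (convex_ball (0 : ℝ) y).isPreconnected (fun n z _ => (hasDerivAt_pow n z).const_mul _)
    (fun n z hz => hterm n (by simpa using (Metric.mem_ball.1 hz).le)) (by simpa using hy0)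
    (hp.summable_norm_mul_pow (x := 0) (by simp)).of_norm (by simpa using hxy)
  refine hderiv.congr_deriv ?_
  rw [(Summable.of_norm_bounded hmaj fun n => hterm n hxy.le).tsum_eq_zero_add, evalSeries]
  simp only [Nat.cast_zero, zero_mul, mul_zero, zero_add]
  refine tsum_congr fun n => ?_
  rw [PowerSeries.coeff_derivative]
  push_cast
  ring

lemma tendsto_evalSeries_comp (hp : HasDecay p s) {l : Filter ℝ} {f : ℝ → ℝ}
    (hf : Tendsto f l (𝓝 0)) :
    Tendsto (fun v => evalSeries p (f v)) l (𝓝 (constantCoeff p)) := by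
  have hcont := (hp.hasDerivAt_evalSeries (x := 0) (by simp)).continuousAt.tendsto
  rw [evalSeries_zero] at hcont
  exact hcont.comp hf

lemma evalSeries_mul (hp : HasDecay p s) (hq : HasDecay q t) (hx : |x| < 1) :
    evalSeries (p * q) x = evalSeries p x * evalSeries q x := by
  rw [evalSeries, evalSeries, evalSeries,
    tsum_mul_tsum_eq_tsum_sum_antidiagonal_of_summable_norm (hp.summable_norm_mul_pow hx)
      (hq.summable_norm_mul_pow hx)]
  refine tsum_congr fun n => ?_
  rw [PowerSeries.coeff_mul, Finset.sum_mul]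
  refine Finset.sum_congr rfl fun ij hij => ?_
  rw [← Finset.HasAntidiagonal.mem_antidiagonal.1 hij, pow_add]
  ring

end HasDecay

end Evaluation

lemma evalSeries_sincSeries {v : ℝ} (hv : 0 < v) :
    evalSeries sincSeries v = Real.sin (Real.pi * √v) / (Real.pi * √v) := by
  have := Real.sqrt_pos.2 hv
  have := Real.pi_pos
  rw [← ((Real.hasSum_sin (Real.pi * √v)).div_const (Real.pi * √v)).tsum_eq, evalSeries]
  refine tsum_congr fun n => ?_
  rw [sincSeries, PowerSeries.coeff_mk, pow_succ (Real.pi * √v), pow_mul (Real.pi * √v),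
    mul_pow Real.pi, Real.sq_sqrt hv.le, neg_pow, mul_pow]
  field_simp

lemma tsum_coeff_sincHalfSeries : ∑' n, coeff n sincHalfSeries = 2 / Real.pi := by
  have hsqrt : √(1 / 4 : ℝ) = 1 / 2 := by
    rw [Real.sqrt_eq_iff_mul_self_eq (by norm_num) (by norm_num)]
    norm_num
  rw [sincHalfSeries, tsum_coeff_rescale, evalSeries_sincSeries (by norm_num), hsqrt, mul_one_div,
    Real.sin_pi_div_two, one_div_div]

lemma tsum_coeff_cscHalfSeries : ∑' n, coeff n cscHalfSeries = Real.pi / 2 := by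
  have hmul := (rapidDecay_sincSeries 0).evalSeries_mul hasDecay_cscSeries
    (x := 1 / 4) (by norm_num [abs_lt])
  rw [sincSeries_mul_cscSeries, ← tsum_coeff_rescale, ← tsum_coeff_rescale, ← tsum_coeff_rescale,
    ← sincHalfSeries, ← cscHalfSeries, tsum_coeff_sincHalfSeries, map_one] at hmul
  have hone : ∑' n, coeff n (1 : ℝ⟦X⟧) = 1 := by
    rw [tsum_eq_single 0 fun n hn => by rw [PowerSeries.coeff_one, if_neg hn]]
    simp
  rw [hone] at hmul
  have := Real.pi_pos
  field_simp at hmul ⊢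
  exact hmul.symm

/-! ### The coefficients of the Legendre series -/

lemma abs_coeff_mul_le_mul_sum {p : ℝ⟦X⟧} {B : ℝ} (hp : ∀ m, |coeff m p| ≤ B) (q : ℝ⟦X⟧) (n : ℕ) :
    |coeff n (p * q)| ≤ B * ∑ j ∈ Finset.range (n + 1), |coeff j q| := by
  rw [mul_comm p, PowerSeries.coeff_mul, Finset.Nat.sum_antidiagonal_eq_sum_range_succ_mk,
    Finset.mul_sum]
  refine (Finset.abs_sum_le_sum_abs _ _).trans (Finset.sum_le_sum fun j _ => ?_)
  rw [abs_mul, mul_comm]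
  exact mul_le_mul_of_nonneg_right (hp _) (abs_nonneg _)

lemma HasDecay.mul_of_summable {p q : ℝ⟦X⟧} (hp : HasDecay p 0)
    (hq : Summable fun n => |coeff n q|) : HasDecay (p * q) 0 := by
  obtain ⟨B, hB⟩ := hasDecay_iff.1 hp
  simp only [neg_zero, Real.rpow_zero, mul_one] at hB
  have hB0 : 0 ≤ B := (abs_nonneg _).trans (hB 0)
  refine hasDecay_iff.2 ⟨B * ∑' j, |coeff j q|, fun n => ?_⟩
  rw [neg_zero, Real.rpow_zero, mul_one]
  exact (abs_coeff_mul_le_mul_sum hB q n).trans (mul_le_mul_of_nonneg_left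
    (hq.sum_le_tsum _ fun _ _ => abs_nonneg _) hB0)

lemma exists_forall_abs_le_mul {a w : ℕ → ℝ} (hw : ∀ n, 0 < w n) {N : ℕ}
    (h : ∀ M, 0 ≤ M → ∀ n ≥ N, (∀ j < n, |a j| ≤ M * w j) → |a n| ≤ M * w n) :
    ∃ M, ∀ n, |a n| ≤ M * w n := by
  have hnonneg (j : ℕ) : 0 ≤ |a j| / w j := div_nonneg (abs_nonneg _) (hw j).le
  refine ⟨∑ j ∈ Finset.range N, |a j| / w j, fun n => ?_⟩
  induction n using Nat.strong_induction_on with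
  | _ n ih =>
    rcases lt_or_ge n N with hn | hn
    · rw [← div_le_iff₀ (hw n)]
      exact Finset.single_le_sum (f := fun j => |a j| / w j) (fun j _ => hnonneg j)
        (Finset.mem_range.2 hn)
    · exact h _ (Finset.sum_nonneg fun j _ => hnonneg j) n hn ih

/-- The flux `sinc · v W'` of the differential equation defining `IsLegendreSeries`. -/
def flux (W : ℝ⟦X⟧) : ℝ⟦X⟧ := sincSeries * euler W

lemma cscSeries_mul_flux (W : ℝ⟦X⟧) : cscSeries * flux W = euler W := by
  rw [flux, ← mul_assoc, mul_comm cscSeries, sincSeries_mul_cscSeries, one_mul]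

lemma constantCoeff_flux (W : ℝ⟦X⟧) : constantCoeff (flux W) = 0 := by
  simp [flux, euler_apply]

namespace IsLegendreSeries

variable {W : ℝ⟦X⟧}

lemma derivative_flux (h : IsLegendreSeries W) :
    d⁄dX ℝ (flux W) = C (Real.pi ^ 2 / 16) * (sincSeries * W) := by
  refine mul_left_cancel₀ PowerSeries.X_ne_zero ?_
  rw [← euler_apply, flux, h.ode]
  ring

lemma exists_abs_coeff_succ_flux_le (h : IsLegendreSeries W) :
    ∃ K, 0 ≤ K ∧ ∀ M, 0 ≤ M → ∀ n : ℕ,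
      (∀ j ≤ n, |coeff j W| ≤ M * ((j : ℝ) + 1) ^ (-(1 / 2) : ℝ)) →
      |coeff (n + 1) (flux W)| ≤ K * M * ((n : ℝ) + 1) ^ (-(3 / 2) : ℝ) := by
  refine ⟨Real.pi ^ 2 / 16 * ∑' i, |coeff i sincSeries| * ((i : ℝ) + 1) ^ (1 / 2 : ℝ),
    mul_nonneg (by positivity) (tsum_nonneg fun i => by positivity), fun M hM n hn => ?_⟩
  have hpos : (0 : ℝ) < (n : ℝ) + 1 := n.cast_add_one_pos
  have hcoeff : coeff (n + 1) (flux W) =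
      Real.pi ^ 2 / 16 * coeff n (sincSeries * W) * ((n : ℝ) + 1) ^ (-1 : ℝ) := by
    have hn := congrArg (coeff n) h.derivative_flux
    rw [PowerSeries.coeff_derivative, PowerSeries.coeff_C_mul] at hn
    rw [← hn, Real.rpow_neg_one, mul_inv_cancel_right₀ hpos.ne']
  have hsinc := rapidDecay_sincSeries.abs_coeff_mul_le (by norm_num) hM hn
  rw [hcoeff, abs_mul, abs_mul, abs_of_nonneg (by positivity : 0 ≤ Real.pi ^ 2 / 16),
    abs_of_nonneg (Real.rpow_nonneg hpos.le _)]
  calc Real.pi ^ 2 / 16 * |coeff n (sincSeries * W)| * ((n : ℝ) + 1) ^ (-1 : ℝ)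
      ≤ Real.pi ^ 2 / 16 * ((∑' i, |coeff i sincSeries| * ((i : ℝ) + 1) ^ (1 / 2 : ℝ)) * M *
          ((n : ℝ) + 1) ^ (-(1 / 2) : ℝ)) * ((n : ℝ) + 1) ^ (-1 : ℝ) := by gcongr
    _ = _ := by
        rw [show (-(3 / 2) : ℝ) = -(1 / 2) + -1 by norm_num, Real.rpow_add hpos]
        ring

lemma exists_mul_abs_coeff_le (h : IsLegendreSeries W) :
    ∃ K, ∀ M, 0 ≤ M → ∀ n : ℕ,
      (∀ j < n, |coeff j W| ≤ M * ((j : ℝ) + 1) ^ (-(1 / 2) : ℝ)) → n * |coeff n W| ≤ K * M := by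
  obtain ⟨K, hK0, hK⟩ := h.exists_abs_coeff_succ_flux_le
  obtain ⟨B, hB⟩ := hasDecay_iff.1 hasDecay_cscSeries
  simp only [neg_zero, Real.rpow_zero, mul_one] at hB
  have hB0 : 0 ≤ B := (abs_nonneg _).trans (hB 0)
  have hsum : Summable fun j : ℕ => ((j : ℝ) + 1) ^ (-(3 / 2) : ℝ) :=
    summable_rpow_neg (by norm_num)
  refine ⟨B * (K * ∑' j : ℕ, ((j : ℝ) + 1) ^ (-(3 / 2) : ℝ)), fun M hM n hn => ?_⟩
  calc n * |coeff n W|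
      = |coeff n (cscSeries * flux W)| := by
        rw [cscSeries_mul_flux, coeff_euler, abs_mul, Nat.abs_cast]
    _ ≤ B * ∑ j ∈ Finset.range (n + 1), |coeff j (flux W)| := abs_coeff_mul_le_mul_sum hB _ n
    _ = B * ∑ j ∈ Finset.range n, |coeff (j + 1) (flux W)| := by
        rw [Finset.sum_range_succ', PowerSeries.coeff_zero_eq_constantCoeff_apply,
          constantCoeff_flux, abs_zero, add_zero]
    _ ≤ B * ∑ j ∈ Finset.range n, K * M * ((j : ℝ) + 1) ^ (-(3 / 2) : ℝ) := by
        gcongr with j hj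
        exact hK M hM j fun i hi => hn i (hi.trans_lt (Finset.mem_range.1 hj))
    _ ≤ B * (K * M * ∑' j : ℕ, ((j : ℝ) + 1) ^ (-(3 / 2) : ℝ)) := by
        rw [← Finset.mul_sum]
        gcongr
        exact hsum.sum_le_tsum _ fun j _ => by positivity
    _ = _ := by ring

lemma hasDecay_one_half (h : IsLegendreSeries W) : HasDecay W (1 / 2) := by
  obtain ⟨K, hK⟩ := h.exists_mul_abs_coeff_le
  have hlarge : Tendsto (fun n : ℕ => ((n : ℝ) + 1) ^ (1 / 2 : ℝ)) atTop atTop :=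
    (tendsto_rpow_atTop (by norm_num)).comp
      (tendsto_atTop_add_const_right _ 1 tendsto_natCast_atTop_atTop)
  obtain ⟨N, hN⟩ := eventually_atTop.1 (hlarge.eventually_ge_atTop (2 * K))
  refine hasDecay_iff.2 (exists_forall_abs_le_mul (N := N + 1)
    (fun n => Real.rpow_pos_of_pos n.cast_add_one_pos _) fun M hM n hn hj => ?_)
  have hn1 : (1 : ℝ) ≤ n := by exact_mod_cast (by omega : 1 ≤ n)
  have hroot : ((n : ℝ) + 1) ^ (1 / 2 : ℝ) * ((n : ℝ) + 1) ^ (1 / 2 : ℝ) = n + 1 := by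
    rw [← Real.rpow_add n.cast_add_one_pos]
    norm_num
  rw [Real.rpow_neg n.cast_add_one_pos.le, ← div_eq_mul_inv, le_div_iff₀ (by positivity)]
  have hle := hN n (by omega)
  have hcoeff := hK M hM n hj
  have hpos : (0 : ℝ) < ((n : ℝ) + 1) ^ (1 / 2 : ℝ) := by positivity
  generalize ((n : ℝ) + 1) ^ (1 / 2 : ℝ) = w at *
  refine le_of_mul_le_mul_left ?_ (one_pos.trans_le hn1)
  calc n * (|coeff n W| * w)
      ≤ K * M * w := by
        rw [← mul_assoc]
        exact mul_le_mul_of_nonneg_right hcoeff hpos.le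
    _ = K * w * M := by ring
    _ ≤ n * M := mul_le_mul_of_nonneg_right (by nlinarith) hM

lemma hasDecay_flux_of_hasDecay (h : IsLegendreSeries W) {s : ℝ} (hs : 0 ≤ s)
    (hW : HasDecay W s) : HasDecay (flux W) (s + 1) := by
  refine HasDecay.of_euler ?_
  rw [flux, h.ode]
  exact (rapidDecay_X.mul_hasDecay hs (rapidDecay_sincSeries.mul_hasDecay hs hW)).C_mul _

lemma hasDecay_one (h : IsLegendreSeries W) : HasDecay W 1 := by
  have hflux := (h.hasDecay_flux_of_hasDecay (by norm_num) h.hasDecay_one_half).summable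
    (by norm_num)
  have heuler := hasDecay_cscSeries.mul_of_summable hflux
  rw [cscSeries_mul_flux] at heuler
  simpa using heuler.of_euler

lemma hasDecay_flux (h : IsLegendreSeries W) : HasDecay (flux W) 2 := by
  have hflux := h.hasDecay_flux_of_hasDecay zero_le_one h.hasDecay_one
  rwa [one_add_one_eq_two] at hflux

end IsLegendreSeries

/-! ### The generating function of the squared Wallis ratios -/

/-- The hypergeometric function `₂F₁(1/2, 1/2; 1; z)`, a solution of the Legendre equation in the
variable `z`. -/
def hypergeometricSeries : ℝ⟦X⟧ := .mk landauTerm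

/-- The flux `z (1 - z) F'` of the hypergeometric function `F`. -/
def hypergeometricFlux : ℝ⟦X⟧ := (1 - X) * euler hypergeometricSeries

lemma sum_coeff_hypergeometricFlux (n : ℕ) :
    ∑ j ∈ Finset.range (n + 1), coeff j hypergeometricFlux = n * landauTerm n := by
  rw [← coeff_mk_one_mul, hypergeometricFlux, ← mul_assoc, PowerSeries.mk_one_mul_one_sub_eq_one,
    one_mul, coeff_euler, hypergeometricSeries, PowerSeries.coeff_mk]

lemma constantCoeff_hypergeometricSeries : constantCoeff hypergeometricSeries = 1 := by
  simp [hypergeometricSeries, landauTerm_zero]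

lemma constantCoeff_hypergeometricFlux : constantCoeff hypergeometricFlux = 0 := by
  simp [hypergeometricFlux, euler_apply]

lemma derivative_hypergeometricFlux :
    d⁄dX ℝ hypergeometricFlux = C (1 / 4) * hypergeometricSeries := by
  ext n
  rw [PowerSeries.coeff_derivative, hypergeometricFlux, sub_mul, one_mul, map_sub,
    PowerSeries.coeff_succ_X_mul, coeff_euler, coeff_euler, PowerSeries.coeff_C_mul,
    hypergeometricSeries, PowerSeries.coeff_mk, PowerSeries.coeff_mk, landauTerm_succ]
  push_cast
  field_simp
  ring

lemma landauTerm_mul_wallis (n : ℕ) : landauTerm n * (2 * n + 1) * Real.Wallis.W n = 1 := by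
  induction n with
  | zero => simp [landauTerm_zero, Real.Wallis.W]
  | succ n ih =>
    rw [landauTerm_succ, Real.Wallis.W, Finset.prod_range_succ, ← Real.Wallis.W]
    refine Eq.trans ?_ ih
    push_cast
    field_simp
    ring

lemma tendsto_mul_landauTerm :
    Tendsto (fun n : ℕ => n * landauTerm n) atTop (𝓝 (1 / Real.pi)) := by
  have := Real.pi_pos
  have hhalf : Tendsto (fun n : ℕ => (n : ℝ) / (2 * n + 1)) atTop (𝓝 (1 / 2)) := by
    refine ((tendsto_natCast_div_add_atTop (1 / 2 : ℝ)).mul_const (1 / 2 : ℝ)).congr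
      (fun n => ?_) |>.trans_eq (by rw [one_mul])
    field_simp
  have hquot := hhalf.div Real.Wallis.tendsto_W_nhds_pi_div_two (by positivity)
  rw [div_div_div_cancel_right₀ two_ne_zero] at hquot
  refine hquot.congr fun n => ?_
  have hW : Real.Wallis.W n ≠ 0 := (Real.Wallis.W_pos n).ne'
  simp only [Pi.div_apply]
  field_simp
  linear_combination -(n : ℝ) * landauTerm_mul_wallis n

lemma hasDecay_hypergeometricSeries : HasDecay hypergeometricSeries 1 := by
  have heuler : HasDecay (euler hypergeometricSeries) 0 := hasDecay_zero_iff.2 <| by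
    simpa only [coeff_euler, hypergeometricSeries, PowerSeries.coeff_mk] using
      tendsto_mul_landauTerm.isBigO_one ℝ
  simpa only [zero_add] using heuler.of_euler

lemma hasDecay_hypergeometricFlux : HasDecay hypergeometricFlux 2 := by
  have heuler : HasDecay (euler hypergeometricFlux) 1 := by
    rw [euler_apply, derivative_hypergeometricFlux]
    exact rapidDecay_X.mul_hasDecay zero_le_one (hasDecay_hypergeometricSeries.C_mul _)
  simpa only [one_add_one_eq_two] using heuler.of_euler

lemma evalSeries_hypergeometricSeries_pos {z : ℝ} (hz : z ∈ Set.Ico (0 : ℝ) 1) :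
    0 < evalSeries hypergeometricSeries z := by
  have hsum := (hasDecay_hypergeometricSeries.summable_norm_mul_pow (x := z)
    (by rw [abs_of_nonneg hz.1]; exact hz.2)).of_norm
  refine hsum.tsum_pos (fun n => ?_) 0 ?_
  · rw [hypergeometricSeries, PowerSeries.coeff_mk]
    exact mul_nonneg (sq_nonneg _) (pow_nonneg hz.1 n)
  · simp [hypergeometricSeries, landauTerm_zero]

lemma evalSeries_hypergeometricFlux {z : ℝ} (hz : |z| < 1) :
    evalSeries hypergeometricFlux z =
      z * (1 - z) * evalSeries (d⁄dX ℝ hypergeometricSeries) z := by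
  have hderiv := hasDecay_hypergeometricSeries.derivative
  rw [sub_self] at hderiv
  rw [hypergeometricFlux, euler_apply,
    (rapidDecay_one_sub_X 0).evalSeries_mul (rapidDecay_X.mul_hasDecay le_rfl hderiv) hz,
    evalSeries_one_sub_X, evalSeries_X_mul]
  ring

lemma tendsto_evalSeries_hypergeometricFlux :
    Tendsto (evalSeries hypergeometricFlux) (𝓝[<] 1) (𝓝 (1 / Real.pi)) := by
  refine Real.tendsto_tsum_powerSeries_nhdsWithin_lt ((tendsto_add_atTop_iff_nat 1).1 ?_)
  exact tendsto_mul_landauTerm.congr fun n => (sum_coeff_hypergeometricFlux n).symm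

/-! ### The value of the flux at the logarithmic singularity -/

/-- On `(0, 1)`, `y` solves the Sturm–Liouville equation `(p y')' = q y` with flux `f = p y'`, and
it is the solution that is regular at `0`, normalized by `y(0) = 1`. -/
structure IsRegularSolution (p q y f : ℝ → ℝ) : Prop where
  hasDerivAt : ∀ v ∈ Set.Ioo (0 : ℝ) 1, HasDerivAt y (f v / p v) v
  hasDerivAt_flux : ∀ v ∈ Set.Ioo (0 : ℝ) 1, HasDerivAt f (q v * y v) v
  tendsto : Tendsto y (𝓝[>] 0) (𝓝 1)
  tendsto_flux : Tendsto f (𝓝[>] 0) (𝓝 0)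

lemma eq_of_hasDerivAt_zero_of_tendsto {f : ℝ → ℝ} {c : ℝ}
    (hf : ∀ v ∈ Set.Ioo (0 : ℝ) 1, HasDerivAt f 0 v) (hc : Tendsto f (𝓝[>] 0) (𝓝 c)) {v : ℝ}
    (hv : v ∈ Set.Ioo (0 : ℝ) 1) : f v = c := by
  have hconst (u : ℝ) (hu : u ∈ Set.Ioo (0 : ℝ) 1) : f v = f u :=
    isOpen_Ioo.is_const_of_deriv_eq_zero isPreconnected_Ioo
      (fun x hx => (hf x hx).differentiableAt.differentiableWithinAt)
      (fun x hx => (hf x hx).deriv) hv hu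
  exact tendsto_nhds_unique
    (tendsto_const_nhds.congr' (eventually_of_mem (Ioo_mem_nhdsGT one_pos) hconst)) hc

namespace IsRegularSolution

variable {p q y₁ f₁ y₂ f₂ : ℝ → ℝ} {v : ℝ}

lemma wronskian_eq_zero (h₁ : IsRegularSolution p q y₁ f₁) (h₂ : IsRegularSolution p q y₂ f₂)
    (hv : v ∈ Set.Ioo (0 : ℝ) 1) : f₁ v * y₂ v - y₁ v * f₂ v = 0 := by
  refine eq_of_hasDerivAt_zero_of_tendsto (f := fun v => f₁ v * y₂ v - y₁ v * f₂ v)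
    (fun x hx => ?_) ?_ hv
  · refine (((h₁.hasDerivAt_flux x hx).mul (h₂.hasDerivAt x hx)).sub
      ((h₁.hasDerivAt x hx).mul (h₂.hasDerivAt_flux x hx))).congr_deriv ?_
    ring
  · simpa using (h₁.tendsto_flux.mul h₂.tendsto).sub (h₁.tendsto.mul h₂.tendsto_flux)

lemma eq (h₁ : IsRegularSolution p q y₁ f₁) (h₂ : IsRegularSolution p q y₂ f₂)
    (hy : ∀ v ∈ Set.Ioo (0 : ℝ) 1, y₂ v ≠ 0) (hv : v ∈ Set.Ioo (0 : ℝ) 1) : y₁ v = y₂ v := by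
  rw [← div_eq_one_iff_eq (hy v hv)]
  refine eq_of_hasDerivAt_zero_of_tendsto (f := fun v => y₁ v / y₂ v) (fun x hx => ?_) ?_ hv
  · refine ((h₁.hasDerivAt x hx).div (h₂.hasDerivAt x hx) (hy x hx)).congr_deriv ?_
    rw [div_eq_zero_iff]
    left
    linear_combination (h₁.wronskian_eq_zero h₂ hx) / p x
  · rw [← div_one (1 : ℝ)]
    exact h₁.tendsto.div h₂.tendsto one_ne_zero

lemma flux_eq (h₁ : IsRegularSolution p q y₁ f₁) (h₂ : IsRegularSolution p q y₂ f₂)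
    (hy : ∀ v ∈ Set.Ioo (0 : ℝ) 1, y₂ v ≠ 0) (hv : v ∈ Set.Ioo (0 : ℝ) 1) : f₁ v = f₂ v := by
  refine mul_right_cancel₀ (hy v hv) ?_
  linear_combination h₁.wronskian_eq_zero h₂ hv + f₂ v * h₁.eq h₂ hy hv

end IsRegularSolution

/-- The function `sin (π √v / 2) ^ 2`, the change of variables between the hypergeometric equation
and the equation of `IsLegendreSeries`. -/
def halfVersine (v : ℝ) : ℝ := (1 - Real.cos (Real.pi * √v)) / 2

section

variable {v : ℝ}

lemma pi_mul_sqrt_mem_Ioo (hv : v ∈ Set.Ioo (0 : ℝ) 1) : Real.pi * √v ∈ Set.Ioo 0 Real.pi := by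
  have hs : √v < 1 := by simpa [Real.sqrt_lt' one_pos] using hv.2
  exact ⟨mul_pos Real.pi_pos (Real.sqrt_pos.2 hv.1), mul_lt_of_lt_one_right Real.pi_pos hs⟩

lemma evalSeries_sincSeries_pos (hv : v ∈ Set.Ioo (0 : ℝ) 1) : 0 < evalSeries sincSeries v := by
  rw [evalSeries_sincSeries hv.1]
  exact div_pos (Real.sin_pos_of_mem_Ioo (pi_mul_sqrt_mem_Ioo hv)) (pi_mul_sqrt_mem_Ioo hv).1

lemma halfVersine_mem_Ioo (hv : v ∈ Set.Ioo (0 : ℝ) 1) : halfVersine v ∈ Set.Ioo (0 : ℝ) 1 := by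
  have hsin := Real.sin_pos_of_mem_Ioo (pi_mul_sqrt_mem_Ioo hv)
  have hsq := Real.sin_sq_add_cos_sq (Real.pi * √v)
  unfold halfVersine
  constructor <;> nlinarith

lemma hasDerivAt_halfVersine (hv : v ∈ Set.Ioo (0 : ℝ) 1) :
    HasDerivAt halfVersine (Real.pi ^ 2 / 4 * evalSeries sincSeries v) v := by
  have hs := Real.sqrt_pos.2 hv.1
  have := Real.pi_pos
  refine ((((Real.hasDerivAt_sqrt hv.1.ne').const_mul Real.pi).cos.const_sub 1).div_const
    2).congr_deriv ?_
  rw [evalSeries_sincSeries hv.1]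
  field_simp
  norm_num

lemma continuous_halfVersine : Continuous halfVersine := by
  unfold halfVersine
  fun_prop

lemma halfVersine_mul_one_sub (hv : 0 < v) :
    halfVersine v * (1 - halfVersine v) = Real.pi ^ 2 / 4 * v * evalSeries sincSeries v ^ 2 := by
  have := Real.pi_pos
  rw [evalSeries_sincSeries hv, div_pow, mul_pow, Real.sq_sqrt hv.le, halfVersine]
  field_simp
  linear_combination -4 * Real.sin_sq_add_cos_sq (Real.pi * √v)

lemma tendsto_halfVersine_zero : Tendsto halfVersine (𝓝[>] 0) (𝓝 0) := by
  have hcont := continuous_halfVersine.tendsto 0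
  rw [show halfVersine 0 = 0 by simp [halfVersine]] at hcont
  exact hcont.mono_left nhdsWithin_le_nhds

lemma tendsto_halfVersine_one : Tendsto halfVersine (𝓝[<] 1) (𝓝[<] 1) := by
  have hcont := continuous_halfVersine.tendsto 1
  rw [show halfVersine 1 = 1 by norm_num [halfVersine]] at hcont
  refine tendsto_nhdsWithin_iff.2 ⟨hcont.mono_left nhdsWithin_le_nhds, ?_⟩
  filter_upwards [Ioo_mem_nhdsLT one_pos] with x hx using (halfVersine_mem_Ioo hx).2

lemma abs_lt_one_of_mem_Ioo (hv : v ∈ Set.Ioo (0 : ℝ) 1) : |v| < 1 := by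
  rw [abs_of_pos hv.1]
  exact hv.2

end

lemma isRegularSolution_hypergeometricSeries :
    IsRegularSolution (fun v => v * evalSeries sincSeries v)
      (fun v => Real.pi ^ 2 / 16 * evalSeries sincSeries v)
      (fun v => evalSeries hypergeometricSeries (halfVersine v))
      (fun v => evalSeries hypergeometricFlux (halfVersine v)) where
  hasDerivAt v hv := by
    have hz := abs_lt_one_of_mem_Ioo (halfVersine_mem_Ioo hv)
    refine ((hasDecay_hypergeometricSeries.hasDerivAt_evalSeries hz).comp v
      (hasDerivAt_halfVersine hv)).congr_deriv ?_
    have hv0 := hv.1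
    have hS := evalSeries_sincSeries_pos hv
    rw [evalSeries_hypergeometricFlux hz, halfVersine_mul_one_sub hv.1]
    field_simp
  hasDerivAt_flux v hv := by
    have hz := abs_lt_one_of_mem_Ioo (halfVersine_mem_Ioo hv)
    refine ((hasDecay_hypergeometricFlux.hasDerivAt_evalSeries hz).comp v
      (hasDerivAt_halfVersine hv)).congr_deriv ?_
    rw [derivative_hypergeometricFlux, evalSeries_C_mul]
    ring
  tendsto := by
    simpa only [constantCoeff_hypergeometricSeries] using
      hasDecay_hypergeometricSeries.tendsto_evalSeries_comp tendsto_halfVersine_zero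
  tendsto_flux := by
    simpa only [constantCoeff_hypergeometricFlux] using
      hasDecay_hypergeometricFlux.tendsto_evalSeries_comp tendsto_halfVersine_zero

namespace IsLegendreSeries

variable {W : ℝ⟦X⟧}

lemma evalSeries_flux (h : IsLegendreSeries W) {v : ℝ} (hv : |v| < 1) :
    evalSeries (flux W) v = v * evalSeries sincSeries v * evalSeries (d⁄dX ℝ W) v := by
  have hderiv := h.hasDecay_one.derivative
  rw [sub_self] at hderiv
  rw [flux, euler_apply,
    (rapidDecay_sincSeries 0).evalSeries_mul (rapidDecay_X.mul_hasDecay le_rfl hderiv) hv,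
    evalSeries_X_mul]
  ring

lemma isRegularSolution (h : IsLegendreSeries W) :
    IsRegularSolution (fun v => v * evalSeries sincSeries v)
      (fun v => Real.pi ^ 2 / 16 * evalSeries sincSeries v)
      (evalSeries W) (evalSeries (flux W)) where
  hasDerivAt v hv := by
    refine (h.hasDecay_one.hasDerivAt_evalSeries (abs_lt_one_of_mem_Ioo hv)).congr_deriv ?_
    rw [h.evalSeries_flux (abs_lt_one_of_mem_Ioo hv), mul_div_cancel_left₀]
    exact (mul_pos hv.1 (evalSeries_sincSeries_pos hv)).ne'
  hasDerivAt_flux v hv := by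
    refine (h.hasDecay_flux.hasDerivAt_evalSeries (abs_lt_one_of_mem_Ioo hv)).congr_deriv ?_
    rw [h.derivative_flux, evalSeries_C_mul,
      (rapidDecay_sincSeries 0).evalSeries_mul h.hasDecay_one (abs_lt_one_of_mem_Ioo hv), mul_assoc]
  tendsto := by
    simpa only [h.constantCoeff_eq, id] using
      h.hasDecay_one.tendsto_evalSeries_comp (tendsto_id.mono_left nhdsWithin_le_nhds)
  tendsto_flux := by
    simpa only [constantCoeff_flux, id] using
      h.hasDecay_flux.tendsto_evalSeries_comp (tendsto_id.mono_left nhdsWithin_le_nhds)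

lemma tsum_coeff_flux (h : IsLegendreSeries W) : ∑' n, coeff n (flux W) = 1 / Real.pi := by
  have habel : Tendsto (evalSeries (flux W)) (𝓝[<] 1) (𝓝 (∑' n, coeff n (flux W))) :=
    Real.tendsto_tsum_powerSeries_nhdsWithin_lt
      (h.hasDecay_flux.summable one_lt_two).of_abs.hasSum.tendsto_sum_nat
  refine tendsto_nhds_unique habel
    ((tendsto_evalSeries_hypergeometricFlux.comp tendsto_halfVersine_one).congr' ?_)
  filter_upwards [Ioo_mem_nhdsLT one_pos] with v hv
  refine (h.isRegularSolution.flux_eq isRegularSolution_hypergeometricSeries (fun x hx => ?_)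
    hv).symm
  exact (evalSeries_hypergeometricSeries_pos (Set.Ioo_subset_Ico_self (halfVersine_mem_Ioo hx))).ne'

end IsLegendreSeries

/-! ### The logarithmic singularity -/

/-- The series of `-log (1 - X)`. -/
def logSeries : ℝ⟦X⟧ := .mk fun n => (n : ℝ)⁻¹

lemma coeff_mk_one_mul_logSeries (n : ℕ) :
    coeff n (PowerSeries.mk 1 * logSeries) = (harmonic n : ℝ) := by
  rw [coeff_mk_one_mul, Finset.sum_range_succ', logSeries]
  simp [harmonic]

lemma euler_logSeries : euler logSeries = PowerSeries.mk 1 - C 1 := by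
  ext n
  rw [coeff_euler, logSeries, PowerSeries.coeff_mk, map_sub, PowerSeries.coeff_mk,
    PowerSeries.coeff_C, Pi.one_apply]
  rcases n with _ | n
  · simp
  · rw [mul_inv_cancel₀ (Nat.cast_ne_zero.2 n.succ_ne_zero), if_neg n.succ_ne_zero, sub_zero]

lemma hasDecay_logSeries : HasDecay logSeries 1 := by
  have heuler : HasDecay (euler logSeries) 0 := by
    rw [euler_logSeries]
    exact hasDecay_mk_one.sub (rapidDecay_C 1 0)
  simpa only [zero_add] using heuler.of_euler

namespace IsLegendreSeries

variable {W : ℝ⟦X⟧}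

lemma hasDecay_euler_sub (h : IsLegendreSeries W) :
    HasDecay (euler W - C (2 / Real.pi) * PowerSeries.mk 1) 1 := by
  have hpartial : HasDecay (PowerSeries.mk 1 * flux W - C (1 / Real.pi) * PowerSeries.mk 1) 1 := by
    have hflux : HasDecay (flux W) (1 + 1) := by
      simpa only [one_add_one_eq_two] using h.hasDecay_flux
    refine (hflux.isBigO_sum_sub_tsum le_rfl).congr_left fun n => ?_
    rw [map_sub, coeff_mk_one_mul, PowerSeries.coeff_C_mul, PowerSeries.coeff_mk, Pi.one_apply,
      mul_one, h.tsum_coeff_flux]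
  have hremainder := rapidDecay_cscRemainder.mul_hasDecay zero_le_one
    (h.hasDecay_flux.mono one_le_two)
  have hC : (C (2 / Real.pi) : ℝ⟦X⟧) = C 2 * C (1 / Real.pi) := by rw [← map_mul, mul_one_div]
  convert (hpartial.C_mul 2).add hremainder using 1
  rw [← cscSeries_mul_flux, cscSeries_mul, hC]
  ring

lemma hasDecay_sub_logSeries (h : IsLegendreSeries W) :
    HasDecay (W - C (2 / Real.pi) * logSeries) 2 := by
  have heuler : HasDecay (euler (W - C (2 / Real.pi) * logSeries)) 1 := by
    rw [map_sub, euler_C_mul, euler_logSeries]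
    convert h.hasDecay_euler_sub.add (rapidDecay_C (2 / Real.pi) 1) using 1
    rw [map_one]
    ring
  simpa only [one_add_one_eq_two] using heuler.of_euler

lemma hasDecay_one_sub_X_mul (h : IsLegendreSeries W) : HasDecay ((1 - X) * W) 2 := by
  have heuler : HasDecay (euler ((1 - X) * W)) 1 := by
    have hsub := rapidDecay_one_sub_X.mul_hasDecay zero_le_one h.hasDecay_euler_sub
    have hXW := rapidDecay_X.mul_hasDecay zero_le_one h.hasDecay_one
    convert (hsub.add (rapidDecay_C (2 / Real.pi) 1)).sub hXW using 1
    have hgeom := PowerSeries.mk_one_mul_one_sub_eq_one ℝ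
    have hX : euler (X : ℝ⟦X⟧) = X := by rw [euler_apply, PowerSeries.derivative_X, mul_one]
    rw [Derivation.leibniz, map_sub, Derivation.map_one_eq_zero, hX, smul_eq_mul, smul_eq_mul]
    linear_combination C (2 / Real.pi) * hgeom
  simpa only [one_add_one_eq_two] using heuler.of_euler

lemma hasDecay_cscHalfSeries_mul_sub (h : IsLegendreSeries W) :
    HasDecay (cscHalfSeries * W - logSeries) 2 := by
  have hmul := rapidDecay_cscHalfSeries.hasDecay_mul_sub zero_le_two h.hasDecay_one_sub_X_mul
  rw [tsum_coeff_cscHalfSeries] at hmul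
  have hC : (C (Real.pi / 2) : ℝ⟦X⟧) * C (2 / Real.pi) = 1 := by
    have := Real.pi_pos
    rw [← map_mul, ← map_one C]
    field_simp
  convert hmul.add (h.hasDecay_sub_logSeries.C_mul (Real.pi / 2)) using 1
  linear_combination logSeries * hC

lemma hasDecay_cscSeries_mul_sub (h : IsLegendreSeries W) :
    HasDecay (cscSeries * W - C (4 / Real.pi) * (PowerSeries.mk 1 * logSeries)) 0 := by
  have hregular := hasDecay_cscSeries.mul_of_summable (h.hasDecay_sub_logSeries.summable one_lt_two)
  have hremainder :=
    rapidDecay_cscRemainder.mul_hasDecay le_rfl (hasDecay_logSeries.mono zero_le_one)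
  have hC : (C (4 / Real.pi) : ℝ⟦X⟧) = C (2 / Real.pi) * C 2 := by
    rw [← map_mul]
    congr 1
    ring
  convert hregular.add (hremainder.C_mul (2 / Real.pi)) using 1
  linear_combination C (2 / Real.pi) * cscSeries_mul logSeries -
    PowerSeries.mk 1 * logSeries * hC

lemma hasDecay_sincHalfSeries_mul_cscSeries_mul_sub (h : IsLegendreSeries W) :
    HasDecay (sincHalfSeries * cscSeries * W -
      C (8 / Real.pi ^ 2) * (PowerSeries.mk 1 * logSeries)) 0 := by
  have hdiff : HasDecay ((1 - X) * (cscSeries * W)) 0 := by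
    rw [mul_left_comm]
    exact hasDecay_cscSeries.mul_of_summable (h.hasDecay_one_sub_X_mul.summable one_lt_two)
  have hmul := rapidDecay_sincHalfSeries.hasDecay_mul_sub le_rfl hdiff
  rw [tsum_coeff_sincHalfSeries] at hmul
  have hC : (C (8 / Real.pi ^ 2) : ℝ⟦X⟧) = C (2 / Real.pi) * C (4 / Real.pi) := by
    rw [← map_mul, div_mul_div_comm, sq]
    norm_num
  convert hmul.add (h.hasDecay_cscSeries_mul_sub.C_mul (2 / Real.pi)) using 1
  linear_combination -(PowerSeries.mk 1 * logSeries) * hC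

end IsLegendreSeries

/-! ### Relative errors -/

lemma isBigO_harmonic_sub_log :
    (fun k : ℕ => (harmonic k : ℝ) - Real.log (2 * k + 1)) =O[atTop] fun _ => (1 : ℝ) := by
  refine IsBigO.of_bound 1 ((eventually_ge_atTop 1).mono fun k hk => ?_)
  have hk' : (1 : ℝ) ≤ k := by exact_mod_cast hk
  have hupper := harmonic_le_one_add_log k
  have hlower := log_add_one_le_harmonic k
  have hlog : Real.log k ≤ Real.log (2 * k + 1) := Real.log_le_log (by linarith) (by linarith)
  have hdouble : Real.log (2 * k + 1) ≤ Real.log 2 + Real.log (k + 1) := by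
    rw [← Real.log_mul two_ne_zero (by positivity)]
    exact Real.log_le_log (by linarith) (by linarith)
  push_cast at hlower
  rw [norm_one, mul_one, Real.norm_eq_abs, abs_le]
  constructor <;> linarith [Real.log_two_lt_d9]

lemma isBigO_mul_sub_one {e : ℕ → ℝ}
    (he : (fun k => e k - (k : ℝ)⁻¹) =O[atTop] fun k : ℕ => ((k : ℝ) + 1) ^ (-2 : ℝ)) :
    (fun k : ℕ => (2 * k - 1) / 2 * e k - 1) =O[atTop] fun k : ℕ => 1 / (k : ℝ) := by
  have hlin : (fun k : ℕ => (2 * (k : ℝ) - 1) / 2) =O[atTop] fun k : ℕ => (k : ℝ) + 1 :=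
    .of_bound' <| .of_forall fun k => by
      have := k.cast_nonneg (α := ℝ)
      rw [Real.norm_eq_abs, Real.norm_of_nonneg k.cast_add_one_pos.le, abs_le]
      constructor <;> linarith
  have herror : (fun k : ℕ => (2 * (k : ℝ) - 1) / 2 * (e k - (k : ℝ)⁻¹)) =O[atTop]
      fun k : ℕ => 1 / (k : ℝ) := by
    refine (hlin.mul he).trans (.of_bound' <| (eventually_ge_atTop 1).mono fun k hk => ?_)
    have : (1 : ℝ) ≤ k := by exact_mod_cast hk
    have hpow : ((k : ℝ) + 1) * ((k : ℝ) + 1) ^ (-2 : ℝ) = 1 / (k + 1) := by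
      rw [Real.rpow_neg k.cast_add_one_pos.le, Real.rpow_two]
      field_simp
    rw [hpow, Real.norm_of_nonneg (by positivity), Real.norm_of_nonneg (by positivity)]
    gcongr
    linarith
  refine (herror.sub ((isBigO_refl _ _).const_mul_left (1 / 2))).congr'
    ((eventually_ne_atTop 0).mono fun k hk => ?_) .rfl
  have hk' : (k : ℝ) ≠ 0 := Nat.cast_ne_zero.2 hk
  dsimp only
  field_simp
  ring

lemma isBigO_div_log_sub_one {e : ℕ → ℝ} {c : ℝ} (hc : c ≠ 0)
    (he : (fun k => e k - c * Real.log (2 * k + 1)) =O[atTop] fun _ : ℕ => (1 : ℝ)) :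
    (fun k : ℕ => e k / (c * Real.log (2 * k + 1)) - 1) =O[atTop]
      fun k : ℕ => 1 / Real.log k := by
  have hlog : (fun k : ℕ => 1 / Real.log (2 * k + 1)) =O[atTop] fun k : ℕ => 1 / Real.log k :=
    .of_bound' <| (eventually_ge_atTop 2).mono fun k hk => by
      have hk' : (2 : ℝ) ≤ k := by exact_mod_cast hk
      have hpos : 0 < Real.log k := Real.log_pos (by linarith)
      have hle : Real.log k ≤ Real.log (2 * k + 1) := Real.log_le_log (by linarith) (by linarith)
      rw [Real.norm_of_nonneg (one_div_nonneg.2 (hpos.le.trans hle)),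
        Real.norm_of_nonneg (one_div_nonneg.2 hpos.le)]
      exact one_div_le_one_div_of_le hpos hle
  refine ((he.mul hlog).const_mul_left c⁻¹).congr' ((eventually_gt_atTop 0).mono fun k hk => ?_)
    (.of_forall fun k => one_mul _)
  have hk' : (0 : ℝ) < k := Nat.cast_pos.2 hk
  have hne : Real.log (2 * k + 1) ≠ 0 := (Real.log_pos (by linarith)).ne'
  dsimp only
  field_simp

namespace IsLegendreSeries

variable {W : ℝ⟦X⟧}

lemma isBigO_even_error (h : IsLegendreSeries W) :
    (fun k : ℕ => (2 * k - 1) / 2 * coeff k (cscHalfSeries * W) - 1) =O[atTop]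
      fun k : ℕ => 1 / (k : ℝ) := by
  refine isBigO_mul_sub_one (h.hasDecay_cscHalfSeries_mul_sub.congr_left fun k => ?_)
  rw [map_sub, logSeries, PowerSeries.coeff_mk]

lemma isBigO_odd_error (h : IsLegendreSeries W) :
    (fun k : ℕ => coeff k (sincHalfSeries * cscSeries * W) /
      (8 / Real.pi ^ 2 * Real.log (2 * k + 1)) - 1) =O[atTop] fun k : ℕ => 1 / Real.log k := by
  refine isBigO_div_log_sub_one (c := 8 / Real.pi ^ 2) (by positivity) ?_
  have hdecay := hasDecay_zero_iff.1 h.hasDecay_sincHalfSeries_mul_cscSeries_mul_sub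
  refine (hdecay.add (isBigO_harmonic_sub_log.const_mul_left (8 / Real.pi ^ 2))).congr_left
    fun k => ?_
  rw [map_sub, PowerSeries.coeff_C_mul, coeff_mk_one_mul_logSeries]
  ring

end IsLegendreSeries

end

theorem corollary2 (α : ℕ → ℝ) (hα : IsLandauExpansion α) :
    (∃ δ : ℕ → ℝ, δ =O[atTop] (fun k : ℕ => 1 / (k : ℝ)) ∧
      ∀ k : ℕ, 1 ≤ k →
        α (2 * k) = (-1 : ℝ) ^ (k + 1) *
          (2 * ((2 * k - 2)! : ℝ) / (2 * Real.pi) ^ (2 * k)) * (1 + δ k)) ∧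
    (∃ δ : ℕ → ℝ, δ =O[atTop] (fun k : ℕ => 1 / Real.log (k : ℝ)) ∧
      ∀ k : ℕ, 1 ≤ k →
        α (2 * k + 1) = (-1 : ℝ) ^ (k + 1) *
          (8 * ((2 * k)! : ℝ) * Real.log (2 * (k : ℝ) + 1) / (2 * Real.pi) ^ (2 * k + 2)) *
            (1 + δ k)) := by
  obtain ⟨W, hW, hWα⟩ := hα.exists_isLegendreSeries
  refine ⟨⟨_, hW.isBigO_even_error, fun k hk => ?_⟩, ⟨_, hW.isBigO_odd_error, fun k hk => ?_⟩⟩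
  · rw [expansion_coeff_even hWα hk]
    obtain ⟨k, rfl⟩ := Nat.exists_eq_add_of_le' hk
    rw [show 2 * (k + 1) - 1 = 2 * k + 1 by omega, show 2 * (k + 1) - 2 = 2 * k by omega,
      Nat.factorial_succ]
    push_cast
    ring
  · have := Real.pi_pos
    have hk' : (0 : ℝ) < k := Nat.cast_pos.2 hk
    have hlog : 0 < Real.log (2 * (k : ℝ) + 1) := Real.log_pos (by linarith)
    rw [expansion_coeff_odd hWα, pow_add _ (2 * k) 2]
    field_simp
    ring
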